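/- Let $M_n$ be the complex $n\times n$ matrices, $\mathcal D_n\subset M_n$ the manifold of strictly positive matrices (tangent vectors: all Hermitian matrices), and $\mathcal D_n^1=\{\rho\in\mathcal D_n:\operatorname{Tr}\rho=1\}$ (tangent vectors: Hermitian matrices of trace $0$). A function $f:(0,\infty)\to\mathbb R$ is operator monotone if $0\le f(A)\le f(B)$ for all $n$ and all strictly positive $A\le B$ in $M_n$; it is symmetric if $f(x)=xf(x^{-1})$ for all $x>0$, and normalised if $f(1)=1$. For such $f$ put $c_f(x,y)=\frac1{y f(x/y)}$ for $x,y>0$, and let $c_f(L_\rho,R_\rho)$ be defined by the joint functional calculus of left and right multiplication by $\rho$. For $\varphi\in C^1(0,\infty)$ let $D_\rho\varphi(A)=\frac{d}{dt}\varphi(\rho+tA)\big|_{t=0}$ be the differential of $\rho\mapsto\varphi(\rho)$ (functional calculus). Real-valued functions $\varphi,\chi\in C^1(0,\infty)$ *induce a paired monotone metric on $(\mathcal D_n)_n$* (respectively on $(\mathcal D^1_n)_n$) if there is a normalised symmetric operator monotone function $f$ such that $$\operatorname{Tr}\big(D_\rho\varphi(A)\,D_\rho\chi(B)\big)=\operatorname{Tr}\big(A\,c_f(L_\rho,R_\rho)(B)\big)$$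 for all $n$, all $\rho\in\mathcal D_n$ (respectively $\rho\in\mathcal D_n^1$) and all tangent vectors $A,B$ at $\rho$. Two pairs $(\varphi,\chi)$ and $(\tilde\varphi,\tilde\chi)$ are *equivalent on a set $S\subset(0,\infty)$* if there are real constants $A_1,A_2,B_1,B_2$ with $A_1A_2=1$ such that $\tilde\varphi=A_1\varphi+B_1$ and $\tilde\chi=A_2\chi+B_2$ on $S$. **Theorem.** Let $\varphi,\chi:(0,\infty)\to\mathbb R$ be $C^1$. 1. $(\varphi,\chi)$ induce a paired monotone metric on $(\mathcal D_n)_n$ if and only if $(\varphi,\chi)$ is equivalent on $(0,\infty)$ to $\left(\frac{x^p}{p},\frac{x^{1-p}}{1-p}\right)$ for some $p\in[-1,2]\setminus\{0,1\}$, or to $(x,\log x)$, or to $(\log x,x)$. 2. $(\varphi,\chi)$ induce a paired monotone metric on $(\mathcal D^1_n)_n$ if and only if $(\varphi,\chi)$ is equivalent on $(0,1]$ to one of these same pairs. -/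

import Mathlib

open Set Matrix
open scoped ComplexOrder

noncomputable section

/-- `f : (0,∞) → ℝ` is operator monotone: `0 < A ≤ B` implies `0 ≤ f(A) ≤ f(B)` for complex
matrices of every size. Only the values of `f` on `(0,∞)` matter. -/
def IsOperatorMonotone (f : ℝ → ℝ) : Prop :=
  ∀ (n : ℕ) (A B : Matrix (Fin n) (Fin n) ℂ), A.PosDef → B.PosDef → (B - A).PosSemidef →
    (cfc f A).PosSemidef ∧ (cfc f B - cfc f A).PosSemidef

/-- Symmetric normalised operator monotone functions. -/
structure IsNormalisedSymmetricOperatorMonotone (f : ℝ → ℝ) : Prop where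
  operatorMonotone : IsOperatorMonotone f
  symmetric : ∀ x : ℝ, 0 < x → f x = x * f x⁻¹
  normalised : f 1 = 1

/-- The Chentsov–Morotzova function `c_f(x,y) = 1 / (y f(x / y))`. -/
def cmFunction (f : ℝ → ℝ) (x y : ℝ) : ℝ := 1 / (y * f (x * y⁻¹))

/-- `c(L_ρ, R_ρ)(B)` for a function `c` of two variables, where `L_ρ`, `R_ρ` are left and right
multiplication by `ρ` (joint functional calculus of two commuting self-adjoint operators).
In an orthonormal eigenbasis of `ρ`, with eigenvalues `lᵢ`, the `(i,j)` entry of `B` is multiplied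
by `c(lᵢ, lⱼ)`. -/
def leftRightCalculus {n : ℕ} (c : ℝ → ℝ → ℝ) {ρ : Matrix (Fin n) (Fin n) ℂ}
    (hρ : ρ.IsHermitian) (B : Matrix (Fin n) (Fin n) ℂ) : Matrix (Fin n) (Fin n) ℂ :=
  let U : Matrix (Fin n) (Fin n) ℂ := hρ.eigenvectorUnitary
  U * Matrix.of (fun i j => (c (hρ.eigenvalues i) (hρ.eigenvalues j) : ℂ) * (Uᴴ * B * U) i j) * Uᴴ

/-- The differential `D_ρ φ (A)` of `ρ ↦ φ(ρ)` (functional calculus) at `ρ` in the direction of the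
tangent vector `A`, that is, the derivative at `t = 0` of `φ(ρ + t A)`. -/
def calculusDifferential {n : ℕ} (φ : ℝ → ℝ) (ρ A : Matrix (Fin n) (Fin n) ℂ) :
    Matrix (Fin n) (Fin n) ℂ :=
  deriv (fun t : ℝ => cfc φ (ρ + t • A)) 0

/-- The paired form `⟨A, B⟩_ρ = Tr (D_ρ φ (A) · D_ρ χ (B))`. -/
def pairedForm {n : ℕ} (φ χ : ℝ → ℝ) (ρ A B : Matrix (Fin n) (Fin n) ℂ) : ℂ :=
  (calculusDifferential φ ρ A * calculusDifferential χ ρ B).trace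

/-- The monotone metric `Tr (A · c_f(L_ρ, R_ρ)(B))` associated with `f`. -/
def monotoneMetric {n : ℕ} (f : ℝ → ℝ) {ρ : Matrix (Fin n) (Fin n) ℂ} (hρ : ρ.IsHermitian)
    (A B : Matrix (Fin n) (Fin n) ℂ) : ℂ :=
  (A * leftRightCalculus (cmFunction f) hρ B).trace

/-- `(φ, χ)` induce a paired monotone metric on the manifolds of all strictly positive
`n × n` matrices (tangent vectors: Hermitian matrices). -/
def InducesPairedMonotoneMetric (φ χ : ℝ → ℝ) : Prop :=
  ∃ f : ℝ → ℝ, IsNormalisedSymmetricOperatorMonotone f ∧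
    ∀ (n : ℕ) (ρ : Matrix (Fin n) (Fin n) ℂ) (hρ : ρ.PosDef) (A B : Matrix (Fin n) (Fin n) ℂ),
      A.IsHermitian → B.IsHermitian →
        pairedForm φ χ ρ A B = monotoneMetric f hρ.isHermitian A B

/-- `(φ, χ)` induce a paired monotone metric on the manifolds of strictly positive `n × n` density
matrices (tangent vectors: Hermitian matrices of trace zero). -/
def InducesPairedMonotoneMetricOnDensities (φ χ : ℝ → ℝ) : Prop :=
  ∃ f : ℝ → ℝ, IsNormalisedSymmetricOperatorMonotone f ∧
    ∀ (n : ℕ) (ρ : Matrix (Fin n) (Fin n) ℂ) (hρ : ρ.PosDef), ρ.trace = 1 →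
      ∀ A B : Matrix (Fin n) (Fin n) ℂ,
        A.IsHermitian → A.trace = 0 → B.IsHermitian → B.trace = 0 →
          pairedForm φ χ ρ A B = monotoneMetric f hρ.isHermitian A B

/-- Affine equivalence, on the set `s`, of the pairs `(φ₁, χ₁)` and `(φ₂, χ₂)`. -/
def AffineEquivalentOn (s : Set ℝ) (φ₁ χ₁ φ₂ χ₂ : ℝ → ℝ) : Prop :=
  ∃ A₁ A₂ B₁ B₂ : ℝ, A₁ * A₂ = 1 ∧
    ∀ x ∈ s, φ₂ x = A₁ * φ₁ x + B₁ ∧ χ₂ x = A₂ * χ₁ x + B₂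

/-- On `s`, up to affine equivalence, `(φ, χ)` is `(x^p / p, x^(1-p) / (1-p))` with
`p ∈ [-1,2] \ {0,1}`, or `(x, log x)`, or the latter in the other order. -/
def IsWYDPairOn (s : Set ℝ) (φ χ : ℝ → ℝ) : Prop :=
  (∃ p ∈ Icc (-1 : ℝ) 2 \ {0, 1},
      AffineEquivalentOn s (fun x => x ^ p / p) (fun x => x ^ (1 - p) / (1 - p)) φ χ) ∨
    AffineEquivalentOn s (fun x => x) Real.log φ χ ∨
    AffineEquivalentOn s Real.log (fun x => x) φ χ

end

/-!
In an eigenbasis of `ρ`, with eigenvalues `lᵢ`, the differential `D_ρ φ` multiplies the `(i, j)`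
entry by the divided difference `dslope φ lᵢ lⱼ` (`calculusDifferential_eq_leftRightCalculus`).
Hence the paired form is the metric of `f` exactly when
`dslope φ x y * dslope χ x y = cmFunction f x y` for the eigenvalues that occur. On all positive matrices these are all `x, y > 0`; on
densities testing with `3 × 3` matrices gives all pairs with `x + y < 1`.

That identity says that `(φ x - φ y) (χ x - χ y)` is homogeneous of degree one and, on the
diagonal, that `φ' χ' = 1 / x`. For a fixed ratio `r`, differentiating the functional equation at
`x = r y` shows that two continuous functions of `y` have constant sum and product, so they are
constant. The resulting delay equation expresses `φ' (r y)` through `φ (r y) - φ y`, and a second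
argument of the same kind shows that this difference is a power of `y` (`exists_deriv_eq_rpow`).
So `φ' = C x ^ (m - 1)` and `χ' = C⁻¹ x ^ (-m)`. Since `f` is increasing on scalars, `f ≥ 1` on
`[1, ∞)`, which forces `-1 ≤ m ≤ 2`.

Conversely, for the standard pairs the function `c x = dslope φ 1 x * dslope χ 1 x` is a mixture,
with positive weights, of the functions `1 / (a x + b)` with `a, b ≥ 0`: for `0 < p < 1` and
`1 < p < 2` this follows from the integral representation of the power function with exponent `p` and
`p - 1` respectively, for `(x, log x)` from `log x / (x - 1) = ∫₀¹ ds / (s x + 1 - s)`, and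
`p = 2` is explicit. The remaining pairs arise by exchanging `φ` and `χ`. The functions `1 / (a x + b)`
are operator antitone, and mixtures preserve this (`isOperatorAntitone_integral`), so `f = 1 / c`
is operator monotone.
-/

/-! ### The differential of the functional calculus -/

open Polynomial in
/-- Hermite interpolation of values and first derivatives. -/
theorem exists_polynomial_eval_eq_and_derivative_eval_eq (s : Finset ℝ) (f g : ℝ → ℝ) :
    ∃ q : ℝ[X], ∀ x ∈ s, q.eval x = f x ∧ q.derivative.eval x = g x := by
  set p := Lagrange.interpolate s id f with hp
  set m := Lagrange.nodal s (id : ℝ → ℝ) with hm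
  set r := Lagrange.interpolate s id
    (fun x => (g x - p.derivative.eval x) / m.derivative.eval x) with hr
  refine ⟨p + m * r, fun x hx => ?_⟩
  have hinj : Set.InjOn (id : ℝ → ℝ) s := Function.injective_id.injOn
  have hm0 : m.eval x = 0 := Lagrange.eval_nodal_at_node (v := id) hx
  have hm1 : m.derivative.eval x ≠ 0 := by
    have := Lagrange.eval_nodal_derivative_eval_node_eq (v := (id : ℝ → ℝ)) hx
    simp only [id] at this
    rw [hm, this, Lagrange.eval_nodal]
    refine Finset.prod_ne_zero_iff.2 fun y hy => sub_ne_zero.2 ?_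
    exact (Finset.ne_of_mem_erase hy).symm
  have hpx : p.eval x = f x := Lagrange.eval_interpolate_at_node f hinj hx
  have hrx : r.eval x = (g x - p.derivative.eval x) / m.derivative.eval x :=
    Lagrange.eval_interpolate_at_node _ hinj hx
  constructor
  · simp [hm0, hpx]
  · simp only [derivative_add, derivative_mul, eval_add, eval_mul, hm0, hrx]
    field_simp
    ring

theorem dslope_comm (f : ℝ → ℝ) (x y : ℝ) : dslope f x y = dslope f y x := by
  rcases eq_or_ne x y with rfl | h
  · rfl
  · rw [dslope_of_ne _ h.symm, dslope_of_ne _ h, slope_comm]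

theorem conjTranspose_eigenvectorUnitary_mul_self {n : ℕ} {ρ : Matrix (Fin n) (Fin n) ℂ}
    (hρ : ρ.IsHermitian) :
    (hρ.eigenvectorUnitary : Matrix (Fin n) (Fin n) ℂ)ᴴ * hρ.eigenvectorUnitary = 1 :=
  Unitary.coe_star_mul_self hρ.eigenvectorUnitary

theorem eigenvectorUnitary_mul_conjTranspose_self {n : ℕ} {ρ : Matrix (Fin n) (Fin n) ℂ}
    (hρ : ρ.IsHermitian) :
    (hρ.eigenvectorUnitary : Matrix (Fin n) (Fin n) ℂ) *
      (hρ.eigenvectorUnitary : Matrix (Fin n) (Fin n) ℂ)ᴴ = 1 :=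
  Unitary.coe_mul_star_self hρ.eigenvectorUnitary

theorem cfc_eq_conj_diagonal {n : ℕ} {ρ : Matrix (Fin n) (Fin n) ℂ}
    (hρ : ρ.IsHermitian) (f : ℝ → ℝ) :
    cfc f ρ = (hρ.eigenvectorUnitary : Matrix (Fin n) (Fin n) ℂ) *
      diagonal (fun i => (f (hρ.eigenvalues i) : ℂ)) *
      (hρ.eigenvectorUnitary : Matrix (Fin n) (Fin n) ℂ)ᴴ := by
  rw [hρ.cfc_eq, IsHermitian.cfc]
  rfl

theorem eq_conj_diagonal {n : ℕ} {ρ : Matrix (Fin n) (Fin n) ℂ}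
    (hρ : ρ.IsHermitian) :
    ρ = (hρ.eigenvectorUnitary : Matrix (Fin n) (Fin n) ℂ) *
      diagonal (fun i => (hρ.eigenvalues i : ℂ)) *
      (hρ.eigenvectorUnitary : Matrix (Fin n) (Fin n) ℂ)ᴴ := by
  conv_lhs => rw [hρ.spectral_theorem]
  rfl

theorem leftRightCalculus_add {n : ℕ} {ρ : Matrix (Fin n) (Fin n) ℂ} (hρ : ρ.IsHermitian)
    (c d : ℝ → ℝ → ℝ) (B : Matrix (Fin n) (Fin n) ℂ) :
    leftRightCalculus (fun x y => c x y + d x y) hρ B =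
      leftRightCalculus c hρ B + leftRightCalculus d hρ B := by
  simp only [leftRightCalculus]
  rw [← add_mul, ← mul_add]
  congr 2
  ext i j
  simp [add_mul]

theorem leftRightCalculus_mul_right {n : ℕ} {ρ : Matrix (Fin n) (Fin n) ℂ} (hρ : ρ.IsHermitian)
    (c : ℝ → ℝ → ℝ) (B : Matrix (Fin n) (Fin n) ℂ) :
    leftRightCalculus (fun x y => c x y * y) hρ B = leftRightCalculus c hρ B * ρ := by
  conv_rhs => enter [2]; rw [eq_conj_diagonal hρ]
  have h := conjTranspose_eigenvectorUnitary_mul_self hρ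
  simp only [leftRightCalculus]
  set U := (hρ.eigenvectorUnitary : Matrix (Fin n) (Fin n) ℂ)
  set W := Matrix.of fun i j => ((c (hρ.eigenvalues i) (hρ.eigenvalues j) : ℝ) : ℂ) *
    (Uᴴ * B * U) i j
  have : ∀ D : Matrix (Fin n) (Fin n) ℂ, U * W * Uᴴ * (U * D * Uᴴ) = U * (W * D) * Uᴴ := by
    intro D
    calc _ = U * W * (Uᴴ * U) * D * Uᴴ := by simp only [mul_assoc]
      _ = _ := by rw [h]; simp only [mul_assoc, mul_one]
  rw [this]
  congr 2
  ext i j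
  rw [mul_diagonal]
  simp [W]
  ring

theorem leftRightCalculus_left {n : ℕ} {ρ : Matrix (Fin n) (Fin n) ℂ} (hρ : ρ.IsHermitian)
    (f : ℝ → ℝ) (B : Matrix (Fin n) (Fin n) ℂ) :
    leftRightCalculus (fun x _ => f x) hρ B = cfc f ρ * B := by
  rw [cfc_eq_conj_diagonal hρ]
  have h := eigenvectorUnitary_mul_conjTranspose_self hρ
  simp only [leftRightCalculus]
  set U := (hρ.eigenvectorUnitary : Matrix (Fin n) (Fin n) ℂ)
  have : ∀ D : Matrix (Fin n) (Fin n) ℂ, U * D * Uᴴ * B = U * (D * (Uᴴ * B * U)) * Uᴴ := by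
    intro D
    calc _ = U * D * Uᴴ * B * (U * Uᴴ) := by rw [h, mul_one]
      _ = _ := by simp only [mul_assoc]
  rw [this]
  congr 2
  ext i j
  rw [diagonal_mul]
  simp

section Differential

open scoped Matrix.Norms.L2Operator
open Polynomial Topology

theorem dslope_eval_mul_X (q : ℝ[X]) (x y : ℝ) :
    dslope (fun z => (q * X).eval z) x y = dslope (fun z => q.eval z) x y * y + q.eval x := by
  rcases eq_or_ne y x with rfl | h
  · rw [dslope_same, dslope_same, Polynomial.deriv, Polynomial.deriv]
    simp
  · rw [dslope_of_ne _ h, dslope_of_ne _ h, slope_def_field, slope_def_field]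
    have := sub_ne_zero.2 h
    simp only [eval_mul, eval_X]
    field_simp
    ring

/-- The Daleckii–Krein formula for polynomials. The induction step is the product rule, which
matches the Leibniz rule `dslope_eval_mul_X` for divided differences. -/
theorem hasDerivAt_aeval_add_smul {n : ℕ} {ρ : Matrix (Fin n) (Fin n) ℂ} (hρ : ρ.IsHermitian)
    (A : Matrix (Fin n) (Fin n) ℂ) (q : ℝ[X]) :
    HasDerivAt (fun t : ℝ => aeval (ρ + t • A) q)
      (leftRightCalculus (dslope fun x => q.eval x) hρ A) 0 := by
  have hlin : HasDerivAt (fun t : ℝ => ρ + t • A) A 0 := by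
    simpa using ((hasDerivAt_id (0 : ℝ)).smul_const A).const_add ρ
  induction q using Polynomial.induction_on with
  | C a =>
    have : leftRightCalculus (dslope fun x => (C a : ℝ[X]).eval x) hρ A = 0 := by
      have h0 : (dslope fun x => (C a : ℝ[X]).eval x) = fun _ _ => (0 : ℝ) := by
        ext x y
        rcases eq_or_ne y x with rfl | h
        · simp [dslope_same]
        · simp [dslope_of_ne _ h, slope_def_field]
      rw [h0]
      simp only [leftRightCalculus]
      convert Matrix.zero_mul _
      convert Matrix.mul_zero _
      ext i j
      simp
    rw [this]
    simpa using hasDerivAt_const (0 : ℝ) (algebraMap ℝ (Matrix (Fin n) (Fin n) ℂ) a)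
  | add p q hp hq =>
    have h0 : (dslope fun x => (p + q).eval x) =
        fun x y => dslope (fun x => p.eval x) x y + dslope (fun x => q.eval x) x y := by
      ext x y
      rcases eq_or_ne y x with rfl | h
      · simp only [dslope_same, Polynomial.deriv, derivative_add]
        rw [eval_add]
      · simp only [dslope_of_ne _ h, slope_def_field, eval_add]
        ring
    rw [h0, leftRightCalculus_add]
    simp only [map_add]
    exact hp.add hq
  | monomial k a ih =>
    have h0 : (dslope fun x => (C a * X ^ (k + 1)).eval x) = fun x y =>
        (dslope (fun x => (C a * X ^ k).eval x) x y * y) + (C a * X ^ k).eval x := by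
      ext x y
      rw [← dslope_eval_mul_X, pow_succ, mul_assoc]
    rw [h0, leftRightCalculus_add, leftRightCalculus_mul_right, leftRightCalculus_left]
    have := ih.mul hlin
    rw [pow_succ, ← mul_assoc]
    rw [show cfc (fun x => (C a * X ^ k : ℝ[X]).eval x) ρ = aeval ρ (C a * X ^ k : ℝ[X]) from
      cfc_polynomial (C a * X ^ k : ℝ[X]) ρ hρ]
    simp only [zero_smul, add_zero] at this
    simp only [map_mul _ (C a * X ^ k) X, aeval_X]
    exact this

/-- A function vanishing to first order on the spectrum of `ρ` has zero differential at `ρ`: on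
the spectrum of `ρ + t A` it is negligible against the polynomial with simple zeros on the
spectrum of `ρ`, whose value at `ρ + t A` is `O(t)`. -/
theorem hasDerivAt_cfc_add_smul_zero {n : ℕ} {ρ A : Matrix (Fin n) (Fin n) ℂ} (hρ : ρ.IsHermitian)
    (hA : A.IsHermitian) {ψ : ℝ → ℝ} (hψ : ∀ x ∈ spectrum ℝ ρ, HasDerivAt ψ 0 x ∧ ψ x = 0):
    HasDerivAt (fun t : ℝ => cfc ψ (ρ + t • A)) 0 0 := by
  have hfin : (spectrum ℝ ρ).Finite := by
    rw [hρ.spectrum_real_eq_range_eigenvalues]; exact Set.finite_range _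
  set m : ℝ[X] := ∏ x ∈ hfin.toFinset, (X - C x) with hm
  have hmroot : ∀ x ∈ spectrum ℝ ρ, m.eval x = 0 := by
    intro x hx
    rw [hm, eval_prod]
    exact Finset.prod_eq_zero (hfin.mem_toFinset.2 hx) (by simp)
  have hmsimple : ∀ x ∈ spectrum ℝ ρ, m.derivative.eval x ≠ 0 := by
    intro x hx
    have h := Lagrange.eval_nodal_derivative_eval_node_eq (v := (id : ℝ → ℝ))
      (hfin.mem_toFinset.2 hx)
    simp only [Lagrange.nodal, id] at h
    rw [hm, h, eval_prod]
    refine Finset.prod_ne_zero_iff.2 fun y hy => ?_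
    rw [eval_sub, eval_X, eval_C]
    exact sub_ne_zero.2 (Finset.ne_of_mem_erase hy).symm
  -- near the spectrum of `ρ`, the function `ψ` is negligible against the polynomial `m`
  have hψm : ∀ x ∈ spectrum ℝ ρ, ψ =o[𝓝 x] fun y => m.eval y := by
    intro x hx
    have h1 : ψ =o[𝓝 x] fun y => y - x := by
      simpa [(hψ x hx).2] using (hasDerivAt_iff_isLittleO.1 (hψ x hx).1)
    have h2 : (fun y => y - x) =O[𝓝 x] fun y => m.eval y := by
      simpa [hmroot x hx, Function.comp_def] using
        ((m.hasDerivAt x).isTheta_sub (hmsimple x hx)).isBigO_symm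
    exact h1.trans_isBigO h2
  have hself : ∀ t : ℝ, IsSelfAdjoint (ρ + t • A) := fun t =>
    hρ.isSelfAdjoint.add ((IsSelfAdjoint.all t).smul hA.isSelfAdjoint)
  have hcont : Filter.Tendsto (fun t : ℝ => ρ + t • A) (𝓝 0) (𝓝 ρ) := by
    have h : Continuous fun t : ℝ => ρ + t • A := by fun_prop
    simpa using h.tendsto 0
  have hlittle : (fun t : ℝ => cfc ψ (ρ + t • A)) =o[𝓝 0] fun t : ℝ => aeval (ρ + t • A) m := by
    rw [Asymptotics.isLittleO_iff]
    intro ε hε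
    have hnear : {y | ‖ψ y‖ ≤ ε * ‖m.eval y‖} ∈ 𝓝ˢ (spectrum ℝ ρ) :=
      mem_nhdsSet_iff_forall.2 fun x hx => (hψm x hx).def hε
    have hev := hcont.eventually
      (upperHemicontinuous_spectrum ℝ (Matrix (Fin n) (Fin n) ℂ) ρ _ hnear)
    filter_upwards [hev] with t ht
    refine norm_cfc_le (by positivity) fun x hx => (subset_of_mem_nhdsSet ht hx).trans ?_
    gcongr
    rw [← cfc_polynomial m (ρ + t • A) (hself t)]
    exact norm_apply_le_norm_cfc (fun y => m.eval y) (ρ + t • A) hx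
      m.continuous.continuousOn (hself t)
  have hbig : (fun t : ℝ => aeval (ρ + t • A) m) =O[𝓝 0] fun t : ℝ => t := by
    have h0 : aeval ρ m = 0 := by
      rw [← cfc_polynomial m ρ hρ.isSelfAdjoint, cfc_congr hmroot]
      exact cfc_const_zero ℝ ρ
    have := (hasDerivAt_aeval_add_smul hρ A m).isBigO_sub
    simpa [h0] using this
  have h0 : cfc ψ ρ = 0 := by
    rw [cfc_congr (g := fun _ => 0) fun x hx => (hψ x hx).2]
    exact cfc_const_zero ℝ ρ
  rw [hasDerivAt_iff_isLittleO_nhds_zero]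
  simpa [h0] using hlittle.trans_isBigO hbig

/-- The Daleckii–Krein formula. Differentiability on the spectrum of `ρ` is enough: subtracting a
Hermite interpolation polynomial leaves a function that vanishes there to first order. -/
theorem hasDerivAt_cfc_add_smul {n : ℕ} {ρ A : Matrix (Fin n) (Fin n) ℂ} (hρ : ρ.IsHermitian)
    (hA : A.IsHermitian) {φ : ℝ → ℝ} (hφ : ∀ x ∈ spectrum ℝ ρ, DifferentiableAt ℝ φ x) :
    HasDerivAt (fun t : ℝ => cfc φ (ρ + t • A)) (leftRightCalculus (dslope φ) hρ A) 0 := by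
  have hfin : (spectrum ℝ ρ).Finite := by
    rw [hρ.spectrum_real_eq_range_eigenvalues]
    exact Set.finite_range _
  obtain ⟨q, hq⟩ :=
    exists_polynomial_eval_eq_and_derivative_eval_eq hfin.toFinset φ (deriv φ)
  have hq' : ∀ x ∈ spectrum ℝ ρ, q.eval x = φ x ∧ q.derivative.eval x = deriv φ x :=
    fun x hx => hq x (hfin.mem_toFinset.2 hx)
  have hmem : ∀ i, hρ.eigenvalues i ∈ spectrum ℝ ρ := fun i => by
    rw [hρ.spectrum_real_eq_range_eigenvalues]
    exact mem_range_self i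
  have hds : leftRightCalculus (dslope φ) hρ A =
      leftRightCalculus (dslope fun x => q.eval x) hρ A := by
    simp only [leftRightCalculus]
    congr 3
    ext i j
    congr 2
    obtain ⟨hi, hi'⟩ := hq' _ (hmem i)
    obtain ⟨hj, -⟩ := hq' _ (hmem j)
    rcases eq_or_ne (hρ.eigenvalues j) (hρ.eigenvalues i) with h | h
    · rw [h, dslope_same, dslope_same, Polynomial.deriv, hi']
    · rw [dslope_of_ne _ h, dslope_of_ne _ h, slope_def_field, slope_def_field, hi, hj]
  have hψ := hasDerivAt_cfc_add_smul_zero hρ hA (ψ := fun x => φ x - q.eval x) fun x hx => by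
    refine ⟨?_, by simp [(hq' x hx).1]⟩
    have := (hφ x hx).hasDerivAt.sub (q.hasDerivAt x)
    rwa [(hq' x hx).2, sub_self] at this
  have hsum := hψ.add (hasDerivAt_aeval_add_smul hρ A q)
  rw [hds]
  rw [zero_add] at hsum
  have hfun : ∀ t : ℝ, cfc φ (ρ + t • A) =
      cfc (fun x => φ x - q.eval x) (ρ + t • A) + aeval (ρ + t • A) q := by
    intro t
    have hself : IsSelfAdjoint (ρ + t • A) :=
      hρ.isSelfAdjoint.add ((IsSelfAdjoint.all t).smul hA.isSelfAdjoint)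
    have hfint : (spectrum ℝ (ρ + t • A)).Finite := by
      rw [IsHermitian.spectrum_real_eq_range_eigenvalues hself]
      exact Set.finite_range _
    rw [← cfc_polynomial q (ρ + t • A) hself, ← cfc_add _ _ _ (hfint.continuousOn _)
      (hfint.continuousOn _)]
    simp
  simp only [hfun]
  exact hsum

theorem calculusDifferential_eq_leftRightCalculus {n : ℕ} {ρ A : Matrix (Fin n) (Fin n) ℂ}
    (hρ : ρ.IsHermitian) (hA : A.IsHermitian) {φ : ℝ → ℝ}
    (hφ : ∀ x ∈ spectrum ℝ ρ, DifferentiableAt ℝ φ x) :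
    calculusDifferential φ ρ A = leftRightCalculus (dslope φ) hρ A := by
  have h := hasDerivAt_cfc_add_smul hρ hA hφ
  exact @HasDerivAt.deriv ℝ _ (Matrix (Fin n) (Fin n) ℂ) _ _ _ _ _ h

end Differential

/-! ### The two forms in an eigenbasis -/

/-- Both forms to be compared are traces of this shape, hence explicit in an eigenbasis of `ρ`. -/
theorem trace_leftRightCalculus_mul_leftRightCalculus {n : ℕ} {ρ : Matrix (Fin n) (Fin n) ℂ}
    (hρ : ρ.IsHermitian) (c d : ℝ → ℝ → ℝ) (A B : Matrix (Fin n) (Fin n) ℂ) :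
    (leftRightCalculus c hρ A * leftRightCalculus d hρ B).trace =
      ∑ i, ∑ j, ((c (hρ.eigenvalues i) (hρ.eigenvalues j) *
          d (hρ.eigenvalues j) (hρ.eigenvalues i) : ℝ) : ℂ) *
        (((hρ.eigenvectorUnitary : Matrix (Fin n) (Fin n) ℂ)ᴴ * A * hρ.eigenvectorUnitary) i j *
          ((hρ.eigenvectorUnitary : Matrix (Fin n) (Fin n) ℂ)ᴴ * B *
            hρ.eigenvectorUnitary) j i) := by
  have h := conjTranspose_eigenvectorUnitary_mul_self hρ
  simp only [leftRightCalculus]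
  set U := (hρ.eigenvectorUnitary : Matrix (Fin n) (Fin n) ℂ)
  have key : ∀ V W : Matrix (Fin n) (Fin n) ℂ,
      (U * V * Uᴴ * (U * W * Uᴴ)).trace = (V * W).trace := by
    intro V W
    calc _ = (U * (V * (Uᴴ * U) * W * Uᴴ)).trace := by simp only [mul_assoc]
      _ = (V * W * (Uᴴ * U)).trace := by rw [h, trace_mul_comm, mul_one, mul_assoc, h]
      _ = _ := by rw [h, mul_one]
  rw [key]
  simp only [trace, diag, mul_apply (M := Matrix.of _), of_apply]
  refine Finset.sum_congr rfl fun i _ => Finset.sum_congr rfl fun j _ => ?_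
  push_cast
  ring

theorem leftRightCalculus_one {n : ℕ} {ρ : Matrix (Fin n) (Fin n) ℂ} (hρ : ρ.IsHermitian)
    (A : Matrix (Fin n) (Fin n) ℂ) : leftRightCalculus (fun _ _ => 1) hρ A = A := by
  rw [leftRightCalculus_left hρ (fun _ => 1), cfc_const_one ℝ ρ hρ.isSelfAdjoint, one_mul]

theorem monotoneMetric_eq_trace {n : ℕ} {ρ : Matrix (Fin n) (Fin n) ℂ} (hρ : ρ.IsHermitian)
    (f : ℝ → ℝ) (A B : Matrix (Fin n) (Fin n) ℂ) :
    monotoneMetric f hρ A B = (leftRightCalculus (fun _ _ => 1) hρ A *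
      leftRightCalculus (cmFunction f) hρ B).trace := by
  rw [leftRightCalculus_one, monotoneMetric]

theorem cmFunction_comm {f : ℝ → ℝ} (hf : ∀ x : ℝ, 0 < x → f x = x * f x⁻¹) {x y : ℝ}
    (hx : 0 < x) (hy : 0 < y) : cmFunction f x y = cmFunction f y x := by
  have h := hf (x * y⁻¹) (by positivity)
  rw [mul_inv, inv_inv, mul_comm x⁻¹] at h
  rw [cmFunction, cmFunction, h]
  congr 1
  field_simp

theorem pos_of_mem_spectrum_of_posDef {n : ℕ} {ρ : Matrix (Fin n) (Fin n) ℂ} (hρ : ρ.PosDef) {x : ℝ}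
    (hx : x ∈ spectrum ℝ ρ) : 0 < x := by
  rw [hρ.isHermitian.spectrum_real_eq_range_eigenvalues] at hx
  obtain ⟨i, rfl⟩ := hx
  exact hρ.eigenvalues_pos i

theorem eigenvalues_mem_spectrum {n : ℕ} {ρ : Matrix (Fin n) (Fin n) ℂ} (hρ : ρ.IsHermitian)
    (i : Fin n) : hρ.eigenvalues i ∈ spectrum ℝ ρ := by
  rw [hρ.spectrum_real_eq_range_eigenvalues]
  exact mem_range_self i

theorem pairedForm_eq_monotoneMetric {n : ℕ} {ρ A B : Matrix (Fin n) (Fin n) ℂ} (hρ : ρ.PosDef)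
    (hA : A.IsHermitian) (hB : B.IsHermitian) {φ χ f : ℝ → ℝ}
    (hφ : DifferentiableOn ℝ φ (Ioi 0)) (hχ : DifferentiableOn ℝ χ (Ioi 0))
    (h : ∀ x ∈ spectrum ℝ ρ, ∀ y ∈ spectrum ℝ ρ,
      dslope φ x y * dslope χ x y = cmFunction f x y) :
    pairedForm φ χ ρ A B = monotoneMetric f hρ.isHermitian A B := by
  have hd : ∀ {ψ : ℝ → ℝ}, DifferentiableOn ℝ ψ (Ioi 0) → ∀ x ∈ spectrum ℝ ρ,
      DifferentiableAt ℝ ψ x := fun h x hx =>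
    h.differentiableAt (Ioi_mem_nhds (pos_of_mem_spectrum_of_posDef hρ hx))
  rw [pairedForm, calculusDifferential_eq_leftRightCalculus hρ.isHermitian hA (hd hφ),
    calculusDifferential_eq_leftRightCalculus hρ.isHermitian hB (hd hχ), monotoneMetric_eq_trace,
    trace_leftRightCalculus_mul_leftRightCalculus, trace_leftRightCalculus_mul_leftRightCalculus]
  refine Finset.sum_congr rfl fun i _ => Finset.sum_congr rfl fun j _ => ?_
  congr 2
  rw [dslope_comm φ, h _ (eigenvalues_mem_spectrum _ j) _ (eigenvalues_mem_spectrum _ i), one_mul]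

/-- Equality of the two forms, tested on the tangent vectors whose entries in an eigenbasis of `ρ`
are `V` and `W`. -/
theorem sum_dslope_mul_eq_sum_cmFunction {n : ℕ} {ρ : Matrix (Fin n) (Fin n) ℂ} (hρ : ρ.PosDef)
    {φ χ f : ℝ → ℝ} (hφ : DifferentiableOn ℝ φ (Ioi 0)) (hχ : DifferentiableOn ℝ χ (Ioi 0))
    (h : ∀ A B : Matrix (Fin n) (Fin n) ℂ,
        A.IsHermitian → A.trace = 0 → B.IsHermitian → B.trace = 0 →
          pairedForm φ χ ρ A B = monotoneMetric f hρ.isHermitian A B)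
    {V W : Matrix (Fin n) (Fin n) ℂ} (hV : V.IsHermitian) (hV0 : V.trace = 0)
    (hW : W.IsHermitian) (hW0 : W.trace = 0) :
    ∑ i, ∑ j, ((dslope φ (hρ.isHermitian.eigenvalues i) (hρ.isHermitian.eigenvalues j) *
        dslope χ (hρ.isHermitian.eigenvalues i) (hρ.isHermitian.eigenvalues j) : ℝ) : ℂ) *
        (V i j * W j i) =
    ∑ i, ∑ j, (cmFunction f (hρ.isHermitian.eigenvalues j) (hρ.isHermitian.eigenvalues i) : ℂ) *
        (V i j * W j i) := by
  set U := (hρ.isHermitian.eigenvectorUnitary : Matrix (Fin n) (Fin n) ℂ) with hU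
  have hUU : Uᴴ * U = 1 := conjTranspose_eigenvectorUnitary_mul_self hρ.isHermitian
  have htr : ∀ V : Matrix (Fin n) (Fin n) ℂ, (U * V * Uᴴ).trace = V.trace := fun V => by
    rw [trace_mul_comm, ← mul_assoc, hUU, one_mul]
  have hconj : ∀ V : Matrix (Fin n) (Fin n) ℂ, Uᴴ * (U * V * Uᴴ) * U = V := fun V => by
    calc _ = (Uᴴ * U) * V * (Uᴴ * U) := by simp only [mul_assoc]
      _ = V := by rw [hUU, one_mul, mul_one]
  have hVh : (U * V * Uᴴ).IsHermitian := isHermitian_mul_mul_conjTranspose _ hV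
  have hWh : (U * W * Uᴴ).IsHermitian := isHermitian_mul_mul_conjTranspose _ hW
  have hd : ∀ {ψ : ℝ → ℝ}, DifferentiableOn ℝ ψ (Ioi 0) → ∀ x ∈ spectrum ℝ ρ,
      DifferentiableAt ℝ ψ x := fun h x hx =>
    h.differentiableAt (Ioi_mem_nhds (pos_of_mem_spectrum_of_posDef hρ hx))
  have key := h _ _ hVh (by rw [htr, hV0]) hWh (by rw [htr, hW0])
  rw [pairedForm, calculusDifferential_eq_leftRightCalculus hρ.isHermitian hVh (hd hφ),
    calculusDifferential_eq_leftRightCalculus hρ.isHermitian hWh (hd hχ), monotoneMetric_eq_trace,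
    trace_leftRightCalculus_mul_leftRightCalculus,
    trace_leftRightCalculus_mul_leftRightCalculus] at key
  simp only [← hU, hconj, one_mul] at key
  rw [← key]
  refine Finset.sum_congr rfl fun i _ => Finset.sum_congr rfl fun j _ => ?_
  rw [dslope_comm χ]

/-- The tangent vectors used are off-diagonal in an eigenbasis, so they have trace zero. -/
theorem dslope_mul_dslope_eq_cmFunction {n : ℕ} {ρ : Matrix (Fin n) (Fin n) ℂ} (hρ : ρ.PosDef)
    {φ χ f : ℝ → ℝ} (hφ : DifferentiableOn ℝ φ (Ioi 0)) (hχ : DifferentiableOn ℝ χ (Ioi 0))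
    (hf : ∀ x : ℝ, 0 < x → f x = x * f x⁻¹)
    (h : ∀ A B : Matrix (Fin n) (Fin n) ℂ,
        A.IsHermitian → A.trace = 0 → B.IsHermitian → B.trace = 0 →
          pairedForm φ χ ρ A B = monotoneMetric f hρ.isHermitian A B)
    {x y : ℝ} (hx : x ∈ spectrum ℝ ρ) (hy : y ∈ spectrum ℝ ρ) (hxy : x ≠ y) :
    dslope φ x y * dslope χ x y = cmFunction f x y := by
  have hx0 := pos_of_mem_spectrum_of_posDef hρ hx
  have hy0 := pos_of_mem_spectrum_of_posDef hρ hy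
  rw [hρ.isHermitian.spectrum_real_eq_range_eigenvalues] at hx hy
  obtain ⟨i, rfl⟩ := hx
  obtain ⟨j, rfl⟩ := hy
  have hij : i ≠ j := fun h => hxy (by rw [h])
  have hV : (single i j (1 : ℂ) + single j i 1 : Matrix (Fin n) (Fin n) ℂ).IsHermitian := by
    rw [IsHermitian, conjTranspose_add, conjTranspose_single, conjTranspose_single, add_comm]
    simp
  have hV0 : (single i j (1 : ℂ) + single j i 1 : Matrix (Fin n) (Fin n) ℂ).trace = 0 := by
    rw [trace_add, trace_single_eq_of_ne _ _ _ hij, trace_single_eq_of_ne _ _ _ hij.symm, add_zero]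
  have key := sum_dslope_mul_eq_sum_cmFunction hρ hφ hχ h hV hV0 hV hV0
  have hsum : ∀ F : Fin n → Fin n → ℂ, ∑ k, ∑ l, F k l *
      ((single i j (1 : ℂ) + single j i 1 : Matrix (Fin n) (Fin n) ℂ) k l *
        (single i j (1 : ℂ) + single j i 1 : Matrix (Fin n) (Fin n) ℂ) l k) =
      F i j + F j i := by
    intro F
    have hkl : ∀ k l : Fin n, (single i j (1 : ℂ) + single j i 1 : Matrix (Fin n) (Fin n) ℂ) k l *
        (single i j (1 : ℂ) + single j i 1 : Matrix (Fin n) (Fin n) ℂ) l k =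
        (if k = i then if l = j then 1 else 0 else 0) +
        (if k = j then if l = i then 1 else 0 else 0) := by
      intro k l
      simp only [Matrix.add_apply, single_apply]
      grind
    simp only [hkl, mul_add, Finset.sum_add_distrib, mul_ite, mul_one, mul_zero]
    simp
  rw [hsum, hsum, dslope_comm φ (hρ.isHermitian.eigenvalues j),
    dslope_comm χ (hρ.isHermitian.eigenvalues j),
    cmFunction_comm hf hy0 hx0] at key
  have h2 : (2 : ℂ) * ((dslope φ (hρ.isHermitian.eigenvalues i) (hρ.isHermitian.eigenvalues j) *
        dslope χ (hρ.isHermitian.eigenvalues i) (hρ.isHermitian.eigenvalues j) : ℝ) : ℂ) =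
        2 * (cmFunction f (hρ.isHermitian.eigenvalues i) (hρ.isHermitian.eigenvalues j) : ℂ) := by
    linear_combination key
  exact_mod_cast mul_left_cancel₀ two_ne_zero h2

/-- With three eigenvectors `i, j, k` at hand, the trace-zero vectors `Eᵢᵢ - Eⱼⱼ` and `Eᵢᵢ - Eₖₖ`
overlap only in the `(i, i)` entry. -/
theorem deriv_mul_deriv_eq_cmFunction {n : ℕ} {ρ : Matrix (Fin n) (Fin n) ℂ} (hρ : ρ.PosDef)
    (hn : 3 ≤ n)
    {φ χ f : ℝ → ℝ} (hφ : DifferentiableOn ℝ φ (Ioi 0)) (hχ : DifferentiableOn ℝ χ (Ioi 0))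
    (h : ∀ A B : Matrix (Fin n) (Fin n) ℂ,
        A.IsHermitian → A.trace = 0 → B.IsHermitian → B.trace = 0 →
          pairedForm φ χ ρ A B = monotoneMetric f hρ.isHermitian A B)
    {x : ℝ} (hx : x ∈ spectrum ℝ ρ) :
    deriv φ x * deriv χ x = cmFunction f x x := by
  rw [hρ.isHermitian.spectrum_real_eq_range_eigenvalues] at hx
  obtain ⟨i, rfl⟩ := hx
  obtain ⟨j, hj⟩ : ∃ j, j ∉ ({i} : Finset (Fin n)) := by
    by_contra! hc
    have := Finset.card_le_card (show Finset.univ ⊆ ({i} : Finset (Fin n)) from fun k _ => hc k)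
    simp at this; omega
  obtain ⟨k, hk⟩ : ∃ k, k ∉ ({i, j} : Finset (Fin n)) := by
    by_contra! hc
    have := Finset.card_le_card (show Finset.univ ⊆ ({i, j} : Finset (Fin n)) from fun k _ => hc k)
    have h2 := Finset.card_le_two (a := i) (b := j)
    simp only [Finset.card_univ, Fintype.card_fin] at this; omega
  simp only [Finset.mem_insert, Finset.mem_singleton, not_or] at hj hk
  have hV : ∀ a b : Fin n, 
      (Matrix.diagonal (Pi.single a 1 - Pi.single b 1 : Fin n → ℂ)).IsHermitian := by
    intro a b
    refine isHermitian_diagonal_of_self_adjoint _ ?_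
    ext l
    simp only [Pi.star_apply, Pi.sub_apply, Pi.single_apply, star_sub]
    split_ifs <;> simp
  have hV0 : ∀ a b : Fin n, 
      (Matrix.diagonal (Pi.single a 1 - Pi.single b 1 : Fin n → ℂ)).trace = 0 := by
    intro a b
    simp [trace_diagonal, Finset.sum_sub_distrib]
  have key := sum_dslope_mul_eq_sum_cmFunction hρ hφ hχ h (hV i j) (hV0 i j) (hV i k) (hV0 i k)
  have hsum : ∀ F : Fin n → Fin n → ℂ, ∑ a, ∑ b, F a b *
      (Matrix.diagonal (Pi.single i 1 - Pi.single j 1 : Fin n → ℂ) a b *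
        Matrix.diagonal (Pi.single i 1 - Pi.single k 1 : Fin n → ℂ) b a) = F i i := by
    intro F
    have hab : ∀ a b, Matrix.diagonal (Pi.single i 1 - Pi.single j 1 : Fin n → ℂ) a b *
        Matrix.diagonal (Pi.single i 1 - Pi.single k 1 : Fin n → ℂ) b a =
        (if a = i then if b = i then 1 else 0 else 0) := by
      intro a b
      simp only [diagonal_apply, Pi.sub_apply, Pi.single_apply]
      grind
    simp only [hab, mul_ite, mul_one, mul_zero]
    simp
  rw [hsum, hsum, dslope_same, dslope_same] at key
  exact_mod_cast key

theorem mem_spectrum_diagonal {n : ℕ} (d : Fin n → ℝ) (i : Fin n) :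
    d i ∈ spectrum ℝ (diagonal fun k => (d k : ℂ)) := by
  rw [← spectrum.algebraMap_mem_iff ℂ, spectrum_diagonal]
  exact ⟨i, rfl⟩

theorem posDef_diagonal_ofReal {n : ℕ} {d : Fin n → ℝ} (hd : ∀ i, 0 < d i) :
    (diagonal fun k => (d k : ℂ)).PosDef :=
  PosDef.diagonal fun i => by exact_mod_cast hd i

/-! ### The functional equation -/

open Topology

/-- A continuous solution of a quadratic equation with constant coefficients is constant on a
preconnected set. -/
theorem IsPreconnected.exists_eq_const_of_quadratic {s : Set ℝ} (hs : IsPreconnected s) {u : ℝ → ℝ}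
    (hu : ContinuousOn u s) {b c : ℝ} (h : ∀ y ∈ s, u y * (b - u y) = c) :
    ∃ k, ∀ y ∈ s, u y = k := by
  rcases s.eq_empty_or_nonempty with rfl | ⟨y₀, hy₀⟩
  · exact ⟨0, by simp⟩
  refine ⟨u y₀, fun y hy => ?_⟩
  have hsq : EqOn ((fun y => u y - b / 2) ^ 2) ((fun _ => u y₀ - b / 2) ^ 2) s := by
    intro z hz
    simp only [Pi.pow_apply]
    linear_combination h y₀ hy₀ - h z hz
  rcases eq_or_ne (u y₀ - b / 2) 0 with h0 | h0
  · have := hsq hy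
    simp only [Pi.pow_apply, h0] at this
    have := pow_eq_zero_iff (two_ne_zero) |>.1 (this.trans (by norm_num))
    linarith
  · rcases hs.eq_or_eq_neg_of_sq_eq (hu.sub continuousOn_const) continuousOn_const hsq
      (fun _ => h0) with h1 | h1
    · have := h1 hy
      simp only [Pi.sub_apply] at this
      linarith
    · have := h1 hy₀
      simp only [Pi.sub_apply, Pi.neg_apply] at this
      exact absurd (by linarith) h0

/-- The solutions of `y a'(y) = m a(y)` on an interval of positive numbers. -/
theorem exists_eq_const_mul_rpow_of_hasDerivAt {s : Set ℝ} (hs : IsPreconnected s)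
    (hso : IsOpen s) (hpos : s ⊆ Ioi 0) {a : ℝ → ℝ} {m : ℝ}
    (h : ∀ y ∈ s, HasDerivAt a (m * a y / y) y) : ∃ C, ∀ y ∈ s, a y = C * y ^ m := by
  have hd : ∀ y ∈ s, HasDerivAt (fun y => a y * y ^ (-m)) 0 y := by
    intro y hy
    have hy0 : (0 : ℝ) < y := hpos hy
    have := (h y hy).mul (Real.hasDerivAt_rpow_const (p := -m) (Or.inl hy0.ne'))
    refine this.congr_deriv ?_
    rw [Real.rpow_sub_one hy0.ne']
    field_simp
    ring
  obtain ⟨C, hC⟩ := hso.exists_is_const_of_deriv_eq_zero hs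
    (fun y hy => (hd y hy).differentiableAt.differentiableWithinAt) (fun y hy => (hd y hy).deriv)
  refine ⟨C, fun y hy => ?_⟩
  have hy0 : (0 : ℝ) < y := hpos hy
  rw [← hC y hy, mul_assoc, ← Real.rpow_add hy0]
  simp

theorem image_mul_sub_ne_zero {φ : ℝ → ℝ} (hφ : DifferentiableOn ℝ φ (Ioi 0)) {r y : ℝ}
    (hr : 1 < r) (hy : 0 < y) (h : ∀ x ∈ Ioo y (r * y), deriv φ x ≠ 0) : φ (r * y) - φ y ≠ 0 := by
  intro h0
  have hlt : y < r * y := by nlinarith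
  obtain ⟨c, hc, hc'⟩ := exists_deriv_eq_zero hlt
    (hφ.continuousOn.mono fun x hx => lt_of_lt_of_le hy hx.1) (by linarith)
  exact h c hc hc'

/-- The functional equation: if `(φ x - φ y) (χ x - χ y)` is homogeneous of degree one, in the
form `y K(x / y)`, and `φ' χ' = 1 / x`, then `φ'` is a power. Only pairs with `x / y` near one
fixed ratio `r` are used, so the set of admissible `y` may be a short interval `(0, c)`.

With `α y = φ (r y) - φ y` and `β y = χ (r y) - χ y`, the quotients `y φ' (r y) / α y` and
`y χ' (r y) / β y` have constant sum and product, hence are constants `h` and `k`. Then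
`α (y / r) / α y` and `β (y / r) / β y` have constant product and satisfy a linear relation with
constant coefficients, so they are constant as well, and `y α' / α` is constant. -/
theorem exists_deriv_eq_rpow {φ χ K : ℝ → ℝ} {s : Set ℝ} {r : ℝ} (hr : 1 < r)
    (hs : s.OrdConnected) (hso : IsOpen s) (hpos : s ⊆ Ioi 0) (hdiv : ∀ y ∈ s, y / r ∈ s)
    (hφ : DifferentiableOn ℝ φ (Ioi 0)) (hφ' : ContinuousOn (deriv φ) (Ioi 0))
    (hχ : DifferentiableOn ℝ χ (Ioi 0)) 
    (hprod : ∀ y ∈ s, ∀ x ∈ Ioc 0 (r * y), deriv φ x * deriv χ x = 1 / x)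
    (hfun : ∀ y ∈ s, ∀ᶠ x in 𝓝 (r * y), (φ x - φ y) * (χ x - χ y) = y * K (x / y)) :
    ∃ m C : ℝ, ∀ y ∈ s, deriv φ (r * y) = C * (r * y) ^ (m - 1) := by
  have hr0 : 0 < r := by linarith
  rcases s.eq_empty_or_nonempty with rfl | ⟨y₀, hy₀⟩
  · exact ⟨0, 0, by simp⟩
  have hpc : IsPreconnected s := hs.isPreconnected
  have hdφ : ∀ x, 0 < x → HasDerivAt φ (deriv φ x) x := fun x hx =>
    (hφ.differentiableAt (Ioi_mem_nhds hx)).hasDerivAt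
  have hdχ : ∀ x, 0 < x → HasDerivAt χ (deriv χ x) x := fun x hx =>
    (hχ.differentiableAt (Ioi_mem_nhds hx)).hasDerivAt
  have hne : ∀ y ∈ s, ∀ x ∈ Ioo y (r * y), deriv φ x ≠ 0 ∧ deriv χ x ≠ 0 := by
    intro y hy x hx
    have hx0 : 0 < x := lt_trans (hpos hy) hx.1
    have := hprod y hy x ⟨hx0, hx.2.le⟩
    refine mul_ne_zero_iff.1 ?_
    rw [this]
    positivity
  set α : ℝ → ℝ := fun y => φ (r * y) - φ y with hα
  set β : ℝ → ℝ := fun y => χ (r * y) - χ y with hβ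
  have hα0 : ∀ y ∈ s, α y ≠ 0 := fun y hy =>
    image_mul_sub_ne_zero hφ hr (hpos hy) fun x hx => (hne y hy x hx).1
  have hβ0 : ∀ y ∈ s, β y ≠ 0 := fun y hy =>
    image_mul_sub_ne_zero hχ hr (hpos hy) fun x hx => (hne y hy x hx).2
  have hαβ : ∀ y ∈ s, α y * β y = y * K r := by
    intro y hy
    have := (hfun y hy).self_of_nhds
    rwa [mul_div_assoc, div_self (ne_of_gt (hpos hy)), mul_one] at this
  have hK0 : K r ≠ 0 := by
    have := mul_ne_zero (hα0 _ hy₀) (hβ0 _ hy₀)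
    rw [hαβ _ hy₀] at this
    exact right_ne_zero_of_mul this
  -- the derivative of the functional equation in `x` at `x = r y`
  have hKd : ∀ y ∈ s, deriv φ (r * y) * β y + α y * deriv χ (r * y) = deriv K r := by
    intro y hy
    have hy0 : 0 < y := hpos hy
    have hry : 0 < r * y := mul_pos hr0 hy0
    have h1 : HasDerivAt (fun x => (φ x - φ y) * (χ x - χ y) / y)
        ((deriv φ (r * y) * β y + α y * deriv χ (r * y)) / y) (y * r) := by
      rw [mul_comm y r]
      exact (((hdφ _ hry).sub_const _).mul ((hdχ _ hry).sub_const _)).div_const y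
    have h2 : HasDerivAt (fun z => (φ (y * z) - φ y) * (χ (y * z) - χ y) / y)
        ((deriv φ (r * y) * β y + α y * deriv χ (r * y)) / y * y) r :=
      HasDerivAt.comp r h1 (by simpa using (hasDerivAt_id r).const_mul y)
    rw [div_mul_cancel₀ _ hy0.ne'] at h2
    have hcont : Filter.Tendsto (fun z => y * z) (𝓝 r) (𝓝 (r * y)) := by
      rw [mul_comm r]
      exact (continuous_const.mul continuous_id).tendsto r
    have h3 : K =ᶠ[𝓝 r] fun z => (φ (y * z) - φ y) * (χ (y * z) - χ y) / y := by
      filter_upwards [hcont.eventually (hfun y hy)] with z hz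
      rw [hz]
      field_simp
    exact (h2.congr_of_eventuallyEq h3).deriv.symm
  -- the quotient `y φ' (r y) / α y` is a constant `h`
  have hprod' : ∀ y ∈ s, deriv φ (r * y) * deriv χ (r * y) = 1 / (r * y) := fun y hy =>
    hprod y hy _ ⟨mul_pos hr0 (hpos hy), le_rfl⟩
  have hαc : ContinuousOn α s := by
    refine ContinuousOn.sub (hφ.continuousOn.comp (by fun_prop) fun y hy => ?_)
      (hφ.continuousOn.mono hpos)
    exact mul_pos hr0 (hpos hy)
  obtain ⟨h, hh⟩ : ∃ h, ∀ y ∈ s, y * deriv φ (r * y) / α y = h := by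
    refine hpc.exists_eq_const_of_quadratic (b := deriv K r / K r) (c := 1 / (r * K r)) ?_ ?_
    · refine ContinuousOn.div (continuousOn_id.mul (hφ'.comp (by fun_prop) fun y hy => ?_)) hαc hα0
      exact mul_pos hr0 (hpos hy)
    · intro y hy
      have hy0 : y ≠ 0 := ne_of_gt (hpos hy)
      have e1 : deriv K r / K r - y * deriv φ (r * y) / α y = y * deriv χ (r * y) / β y := by
        have := hα0 y hy
        have := hβ0 y hy
        rw [← hKd y hy, show K r = α y * β y / y by rw [hαβ y hy]; field_simp]
        field_simp
        ring
      rw [e1]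
      have e2 : r * K r = r * (α y * β y / y) := by rw [hαβ y hy]; field_simp
      rw [e2]
      have := hα0 y hy
      have := hβ0 y hy
      have e3 := hprod' y hy
      field_simp at e3 ⊢
      linear_combination e3
  set k := deriv K r / K r - h with hk
  have hφr : ∀ y ∈ s, deriv φ (r * y) = h * α y / y := by
    intro y hy
    have := hα0 y hy
    have hy0 : y ≠ 0 := ne_of_gt (hpos hy)
    rw [← hh y hy]
    field_simp
  have hχr : ∀ y ∈ s, deriv χ (r * y) = k * β y / y := by
    intro y hy
    have h1 := hα0 y hy
    have h2 := hβ0 y hy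
    have hy0 : y ≠ 0 := ne_of_gt (hpos hy)
    have h3 := hKd y hy
    rw [hφr y hy] at h3
    have h4 := hαβ y hy
    have h5 : α y * deriv χ (r * y) * K r = α y * (k * β y / y) * K r := by
      have h6 : α y * β y / y = K r := by rw [h4]; field_simp
      have h7 : k * K r = deriv K r - h * K r := by rw [hk]; field_simp
      linear_combination K r * h3 - h * K r * h6 - k * K r * h6 - K r * h7
    exact mul_left_cancel₀ h1 (mul_right_cancel₀ hK0 h5)
  have hrdiv : ∀ y : ℝ, r * (y / r) = y := fun y => by field_simp
  have hdα : ∀ y ∈ s, HasDerivAt α (r * (h * α y / y) - r * h * α (y / r) / y) y := by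
    intro y hy
    have hy0 : 0 < y := hpos hy
    have h1 : HasDerivAt (fun y => φ (r * y)) (deriv φ (r * y) * r) y :=
      HasDerivAt.comp y (hdφ _ (mul_pos hr0 hy0)) (by simpa using (hasDerivAt_id y).const_mul r)
    refine (h1.sub (hdφ _ hy0)).congr_deriv ?_
    have h2 := hφr _ (hdiv y hy)
    rw [hrdiv] at h2
    rw [h2, hφr y hy]
    field_simp
  have hdβ : ∀ y ∈ s, HasDerivAt β (r * (k * β y / y) - r * k * β (y / r) / y) y := by
    intro y hy
    have hy0 : 0 < y := hpos hy
    have h1 : HasDerivAt (fun y => χ (r * y)) (deriv χ (r * y) * r) y :=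
      HasDerivAt.comp y (hdχ _ (mul_pos hr0 hy0)) (by simpa using (hasDerivAt_id y).const_mul r)
    refine (h1.sub (hdχ _ hy0)).congr_deriv ?_
    have h2 := hχr _ (hdiv y hy)
    rw [hrdiv] at h2
    rw [h2, hχr y hy]
    field_simp
  -- the derivative of `α β = y K(r)`
  have hαβd : ∀ y ∈ s, r * h * (1 - α (y / r) / α y) + r * k * (1 - β (y / r) / β y) = 1 := by
    intro y hy
    have hy0 : 0 < y := hpos hy
    have h1 := (hdα y hy).mul (hdβ y hy)
    have h2 : HasDerivAt (α * β) (K r) y := by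
      refine HasDerivAt.congr_of_eventuallyEq (f := fun y => y * K r) ?_ ?_
      · simpa using (hasDerivAt_id y).mul_const (K r)
      · filter_upwards [hso.mem_nhds hy] with z hz
        exact hαβ z hz
    have h3 := h1.unique h2
    have := hα0 y hy
    have := hβ0 y hy
    rw [show K r = α y * β y / y by rw [hαβ y hy]; field_simp] at h3
    field_simp at h3 ⊢
    linear_combination h3
  have hRR : ∀ y ∈ s, α (y / r) / α y * (β (y / r) / β y) = 1 / r := by
    intro y hy
    have hy0 : 0 < y := hpos hy
    rw [div_mul_div_comm, hαβ y hy, hαβ _ (hdiv y hy)]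
    field_simp
  have hhk : h * k = 1 / (r * K r) := by
    have h1 := hprod' _ hy₀
    rw [hφr _ hy₀, hχr _ hy₀] at h1
    have h2 := hαβ _ hy₀
    have hy0 : 0 < y₀ := hpos hy₀
    field_simp at h1 ⊢
    refine mul_left_cancel₀ hy0.ne' ?_
    linear_combination h1 - r * h * k * h2
  have hh0 : h ≠ 0 := by
    rintro rfl
    rw [zero_mul] at hhk
    have : r * K r ≠ 0 := mul_ne_zero hr0.ne' hK0
    exact (one_div_ne_zero this) hhk.symm
  obtain ⟨R, hR⟩ : ∃ R, ∀ y ∈ s, α (y / r) / α y = R := by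
    refine hpc.exists_eq_const_of_quadratic (b := (r * h + r * k - 1) / (r * h))
      (c := k / (h * r)) ?_ ?_
    · exact (hαc.comp (by fun_prop) hdiv).div hαc hα0
    · intro y hy
      have h1 := hαβd y hy
      have h2 := hRR y hy
      generalize α (y / r) / α y = u at h1 h2 ⊢
      generalize β (y / r) / β y = v at h1 h2
      field_simp at h2 ⊢
      linear_combination u * h1 + k * h2
  obtain ⟨C, hC⟩ := exists_eq_const_mul_rpow_of_hasDerivAt hpc hso hpos (a := α)
    (m := r * h * (1 - R)) fun y hy => (hdα y hy).congr_deriv (by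
      have h1 := hα0 y hy
      have h2 := hR y hy
      have hy0 : 0 < y := hpos hy
      rw [div_eq_iff h1] at h2
      rw [h2]
      field_simp)
  refine ⟨r * h * (1 - R), h * C / r ^ (r * h * (1 - R) - 1), fun y hy => ?_⟩
  have hy0 : 0 < y := hpos hy
  rw [hφr y hy, hC y hy, Real.mul_rpow hr0.le hy0.le, Real.rpow_sub_one hy0.ne']
  have : r ^ (r * h * (1 - R) - 1) ≠ 0 := (Real.rpow_pos_of_pos hr0 _).ne'
  field_simp

/-! ### From paired metrics to powers -/

theorem IsOperatorMonotone.le_of_le {f : ℝ → ℝ} (hf : IsOperatorMonotone f) {x y : ℝ} (hx : 0 < x)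
    (hxy : x ≤ y) : f x ≤ f y := by
  have hd : ∀ z : ℝ,
      algebraMap ℝ (Matrix (Fin 1) (Fin 1) ℂ) z = Matrix.diagonal fun _ => (z : ℂ) := by
    intro z
    rw [algebraMap_eq_diagonal]
    rfl
  have hpos : ∀ z : ℝ, 0 < z → (algebraMap ℝ (Matrix (Fin 1) (Fin 1) ℂ) z).PosDef := by
    intro z hz
    rw [hd]
    exact posDef_diagonal_ofReal fun _ => hz
  have h := (hf 1 _ _ (hpos x hx) (hpos y (hx.trans_le hxy)) (by
    rw [hd, hd, diagonal_sub, posSemidef_diagonal_iff]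
    intro i
    simpa [← Complex.ofReal_sub] using hxy)).2
  rw [cfc_algebraMap, cfc_algebraMap, hd, hd, diagonal_sub, posSemidef_diagonal_iff] at h
  simpa using h 0

/-- The left side grows like `x ^ m` when `m > 2`. -/
theorem le_two_of_forall_rpow_le {m : ℝ} (h : ∀ x : ℝ, 1 < x →
    (x ^ m - 1) / m * ((x ^ (1 - m) - 1) / (1 - m)) ≤ (x - 1) ^ 2) : m ≤ 2 := by
  by_contra! hm
  have ht := tendsto_rpow_atTop (sub_pos.2 hm)
  obtain ⟨x, hx, hx2⟩ := ((ht.eventually_gt_atTop (4 * (m * (m - 1)))).and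
    (Filter.eventually_ge_atTop 2)).exists
  have hx0 : 0 < x := by linarith
  have h1 := h x (by linarith)
  have h2 : x ^ (1 - m) ≤ 1 / 2 := by
    calc x ^ (1 - m) ≤ x ^ (-1 : ℝ) := Real.rpow_le_rpow_of_exponent_le (by linarith) (by linarith)
      _ = x⁻¹ := Real.rpow_neg_one x
      _ ≤ 1 / 2 := by rw [one_div]; exact inv_anti₀ (by norm_num) hx2
  have h3 : x ^ m = x ^ (m - 2) * x ^ 2 := by
    rw [← Real.rpow_natCast x 2, ← Real.rpow_add hx0]
    congr 1
    push_cast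
    ring
  have hmm : 0 < m * (m - 1) := by nlinarith
  have h4 : 2 ≤ x ^ m := by
    calc (2 : ℝ) ≤ x := hx2
      _ = x ^ (1 : ℝ) := (Real.rpow_one x).symm
      _ ≤ x ^ m := Real.rpow_le_rpow_of_exponent_le (by linarith) (by linarith)
  have h5 : (x ^ m - 1) / m * ((x ^ (1 - m) - 1) / (1 - m)) =
      (x ^ m - 1) * (1 - x ^ (1 - m)) / (m * (m - 1)) := by
    have : m ≠ 0 := by linarith
    have : m - 1 ≠ 0 := by linarith
    have : 1 - m ≠ 0 := by linarith
    field_simp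
    ring
  rw [h5, div_le_iff₀ hmm] at h1
  have h6 : x ^ m / 4 ≤ (x ^ m - 1) * (1 - x ^ (1 - m)) := by nlinarith
  have h7 : (x - 1) ^ 2 ≤ x ^ 2 := by nlinarith
  have h8 : x ^ m / 4 ≤ x ^ 2 * (m * (m - 1)) := by nlinarith
  rw [h3] at h8
  have h9 : 0 < x ^ 2 := by positivity
  nlinarith

/-- The equality is propagated by continuity from the open set `s` to a set `t` in its closure. -/
theorem exists_eq_add_const_of_deriv_eq {s t : Set ℝ} (hs : IsPreconnected s) (hso : IsOpen s)
    (hst : s ⊆ t) (hts : t ⊆ closure s) (ht : t ⊆ Ioi 0) {φ ψ : ℝ → ℝ}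
    (hφ : DifferentiableOn ℝ φ (Ioi 0)) (hψ : DifferentiableOn ℝ ψ (Ioi 0))
    (h : ∀ x ∈ s, deriv φ x = deriv ψ x) : ∃ B, ∀ x ∈ t, φ x = ψ x + B := by
  have hspos := hst.trans ht
  obtain ⟨B, hB⟩ := hso.exists_is_const_of_deriv_eq_zero hs (f := fun x => φ x - ψ x)
    ((hφ.mono hspos).sub (hψ.mono hspos)) fun x hx => by
      have hn : Ioi (0 : ℝ) ∈ 𝓝 x := Ioi_mem_nhds (mem_Ioi.1 (hspos hx))
      have := deriv_sub (hφ.differentiableAt hn) (hψ.differentiableAt hn)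
      simp only [Pi.zero_apply]
      rw [h x hx, sub_self] at this
      exact this
  refine ⟨B, fun x hx => ?_⟩
  have hEq : EqOn (fun x => φ x - ψ x) (fun _ => B) t :=
    EqOn.of_subset_closure (fun x hx => hB x hx)
      ((hφ.continuousOn.mono ht).sub (hψ.continuousOn.mono ht)) continuousOn_const hst hts
  have := hEq hx
  simp only at this
  linarith

theorem deriv_const_mul_rpow_div {C m x : ℝ} (hm : m ≠ 0) (hx : 0 < x) :
    deriv (fun x => C * (x ^ m / m)) x = C * x ^ (m - 1) := by
  have h := ((Real.hasDerivAt_rpow_const (p := m) (Or.inl hx.ne')).div_const m).const_mul C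
  rw [h.deriv]
  field_simp

theorem deriv_const_mul_log {C x : ℝ} : deriv (fun x => C * Real.log x) x = C * x⁻¹ := by
  rw [deriv_const_mul_field, Real.deriv_log]

theorem isWYDPairOn_of_deriv_eq {s t : Set ℝ} (hs : IsPreconnected s) (hso : IsOpen s)
    (hst : s ⊆ t) (hts : t ⊆ closure s) (ht : t ⊆ Ioi 0) {φ χ : ℝ → ℝ}
    (hφ : DifferentiableOn ℝ φ (Ioi 0)) (hχ : DifferentiableOn ℝ χ (Ioi 0)) {m C : ℝ} (hC : C ≠ 0)
    (hφ' : ∀ x ∈ s, deriv φ x = C * x ^ (m - 1)) (hχ' : ∀ x ∈ s, deriv χ x = C⁻¹ * x ^ (-m))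
    (hm : m ∉ ({0, 1} : Set ℝ) → m ∈ Icc (-1 : ℝ) 2) : IsWYDPairOn t φ χ := by
  have hspos := hst.trans ht
  have hpow : ∀ C p : ℝ, DifferentiableOn ℝ (fun x => C * (x ^ p / p)) (Ioi 0) := fun C p x hx =>
    (((Real.hasDerivAt_rpow_const (p := p) (Or.inl (ne_of_gt hx))).div_const p).const_mul
      C).differentiableAt.differentiableWithinAt
  have hlog : ∀ C : ℝ, DifferentiableOn ℝ (fun x => C * Real.log x) (Ioi 0) := fun C x hx =>
    ((Real.hasDerivAt_log (ne_of_gt hx)).const_mul C).differentiableAt.differentiableWithinAt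
  have hlin : ∀ C : ℝ, DifferentiableOn ℝ (fun x => C * x) (Ioi 0) := fun C => by fun_prop
  have hcc : C * C⁻¹ = 1 := mul_inv_cancel₀ hC
  by_cases h01 : m ∈ ({0, 1} : Set ℝ)
  · rcases h01 with rfl | h01
    · obtain ⟨B₁, h₁⟩ := exists_eq_add_const_of_deriv_eq hs hso hst hts ht hφ (hlog C)
        fun x hx => by
        rw [hφ' x hx, deriv_const_mul_log, zero_sub, Real.rpow_neg_one]
      obtain ⟨B₂, h₂⟩ := exists_eq_add_const_of_deriv_eq hs hso hst hts ht hχ (hlin C⁻¹)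
        fun x hx => by simp [hχ' x hx]
      exact Or.inr (Or.inr ⟨C, C⁻¹, B₁, B₂, hcc, fun x hx => ⟨h₁ x hx, h₂ x hx⟩⟩)
    · rw [mem_singleton_iff] at h01
      subst h01
      obtain ⟨B₁, h₁⟩ := exists_eq_add_const_of_deriv_eq hs hso hst hts ht hφ (hlin C)
        fun x hx => by simp [hφ' x hx]
      obtain ⟨B₂, h₂⟩ := exists_eq_add_const_of_deriv_eq hs hso hst hts ht hχ (hlog C⁻¹)
        fun x hx => by rw [hχ' x hx, deriv_const_mul_log, Real.rpow_neg_one]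
      exact Or.inr (Or.inl ⟨C, C⁻¹, B₁, B₂, hcc, fun x hx => ⟨h₁ x hx, h₂ x hx⟩⟩)
  · have h0 : m ≠ 0 := fun h => h01 (Or.inl h)
    have h1 : 1 - m ≠ 0 := fun h => h01 (Or.inr (by rw [mem_singleton_iff]; linarith))
    obtain ⟨B₁, h₁⟩ := exists_eq_add_const_of_deriv_eq hs hso hst hts ht hφ (hpow C m)
      fun x hx => by rw [hφ' x hx, deriv_const_mul_rpow_div h0 (hspos hx)]
    obtain ⟨B₂, h₂⟩ := exists_eq_add_const_of_deriv_eq hs hso hst hts ht hχ (hpow C⁻¹ (1 - m))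
      fun x hx => by
        rw [hχ' x hx, deriv_const_mul_rpow_div h1 (hspos hx)]
        congr 2
        ring
    exact Or.inl ⟨m, ⟨hm h01, h01⟩, C, C⁻¹, B₁, B₂, hcc, fun x hx => ⟨h₁ x hx, h₂ x hx⟩⟩

theorem rpow_sub_one_params_eq {C C' m m' : ℝ} (hC : C ≠ 0)
    (h2 : C * (1 / 2 : ℝ) ^ (m - 1) = C' * (1 / 2 : ℝ) ^ (m' - 1))
    (h4 : C * (1 / 4 : ℝ) ^ (m - 1) = C' * (1 / 4 : ℝ) ^ (m' - 1)) : C = C' ∧ m = m' := by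
  have e : ∀ p : ℝ, (1 / 4 : ℝ) ^ p = (1 / 2 : ℝ) ^ p * (1 / 2 : ℝ) ^ p := fun p => by
    rw [← Real.mul_rpow (by norm_num) (by norm_num)]
    norm_num
  have hp : ∀ p : ℝ, 0 < (1 / 2 : ℝ) ^ p := fun p => Real.rpow_pos_of_pos (by norm_num) p
  rw [e, e, ← mul_assoc, ← mul_assoc, ← h2] at h4
  have hm' := mul_left_cancel₀ (mul_ne_zero hC (hp (m - 1)).ne') h4
  have hm : m = m' := by
    have := (Real.strictAnti_rpow_of_base_lt_one (b := 1 / 2) (by norm_num)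
      (by norm_num)).injective hm'
    linarith
  subst hm
  exact ⟨mul_right_cancel₀ (hp _).ne' h2, rfl⟩

/-- The functional equation `(φ x - φ y) (χ x - χ y) = y K(x / y)` with
`K z = (z - 1) ^ 2 / f z`. -/
theorem sub_mul_sub_eq_of_dslope {φ χ f : ℝ → ℝ} {x y : ℝ} (hy : 0 < y)
    (h : x ≠ y → dslope φ x y * dslope χ x y = cmFunction f x y) :
    (φ x - φ y) * (χ x - χ y) = y * ((x / y - 1) ^ 2 / f (x / y)) := by
  rcases eq_or_ne x y with rfl | hxy
  · simp [div_self hy.ne']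
  · have h := h hxy
    rw [dslope_of_ne _ hxy.symm, dslope_of_ne _ hxy.symm, slope_def_field, slope_def_field,
      cmFunction, ← div_eq_mul_inv] at h
    have : y - x ≠ 0 := sub_ne_zero.2 hxy.symm
    have e : (φ x - φ y) * (χ x - χ y) =
        (y - x) ^ 2 * ((φ y - φ x) / (y - x) * ((χ y - χ x) / (y - x))) := by
      field_simp
      ring
    rw [e, h, div_sub_one hy.ne', one_div, mul_inv]
    field_simp
    ring

theorem deriv_eq_of_dslope_eq {φ χ f : ℝ → ℝ} {s : Set ℝ} {r : ℝ} (hr : 1 < r)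
    (hs : s.OrdConnected) (hso : IsOpen s) (hpos : s ⊆ Ioi 0) (hdiv : ∀ y ∈ s, y / r ∈ s)
    (hφ : ContDiffOn ℝ 1 φ (Ioi 0)) (hχ : ContDiffOn ℝ 1 χ (Ioi 0)) 
    (hprod : ∀ y ∈ s, ∀ x ∈ Ioc 0 (r * y), deriv φ x * deriv χ x = 1 / x)
    (hfun : ∀ y ∈ s, ∀ᶠ x in 𝓝 (r * y), x ≠ y → dslope φ x y * dslope χ x y = cmFunction f x y) :
    ∃ m C : ℝ, ∀ y ∈ s, deriv φ (r * y) = C * (r * y) ^ (m - 1) :=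
  exists_deriv_eq_rpow (K := fun z => (z - 1) ^ 2 / f z) hr hs hso hpos hdiv
    (hφ.differentiableOn one_ne_zero) (hφ.continuousOn_deriv_of_isOpen isOpen_Ioi le_rfl)
    (hχ.differentiableOn one_ne_zero) hprod fun y hy => by
      filter_upwards [hfun y hy] with x hx
      exact sub_mul_sub_eq_of_dslope (hpos hy) hx

/-- The range of the exponent: monotonicity gives `f ≥ f 1 = 1` on `[1, ∞)`, which bounds the
divided differences at `(x y, y)` by homogeneity. The bound is on `m`; the one on `1 - m` follows
because the bounded expression is symmetric under `m ↦ 1 - m`. -/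
theorem mem_Icc_of_deriv_eq_rpow {φ χ f : ℝ → ℝ} (hf : IsNormalisedSymmetricOperatorMonotone f)
    (hφ : DifferentiableOn ℝ φ (Ioi 0)) (hχ : DifferentiableOn ℝ χ (Ioi 0)) {m C : ℝ} (hC : C ≠ 0)
    (hφ' : ∀ x ∈ Ioo (0 : ℝ) 1, deriv φ x = C * x ^ (m - 1))
    (hχ' : ∀ x ∈ Ioo (0 : ℝ) 1, deriv χ x = C⁻¹ * x ^ (-m))
    (hfun : ∀ x y, 0 < x → 0 < y → x + y < 1 → x ≠ y →
      dslope φ x y * dslope χ x y = cmFunction f x y)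
    (hm : m ∉ ({0, 1} : Set ℝ)) : m ∈ Icc (-1 : ℝ) 2 := by
  have h0 : m ≠ 0 := fun h => hm (Or.inl h)
  have h1 : 1 - m ≠ 0 := fun h => hm (Or.inr (by rw [mem_singleton_iff]; linarith))
  have hpow : ∀ C p : ℝ, DifferentiableOn ℝ (fun x => C * (x ^ p / p)) (Ioi 0) := fun C p x hx =>
    (((Real.hasDerivAt_rpow_const (p := p) (Or.inl (ne_of_gt hx))).div_const p).const_mul
      C).differentiableAt.differentiableWithinAt
  have hsub : Ioo (0 : ℝ) 1 ⊆ Ioi 0 := fun x hx => hx.1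
  obtain ⟨B₁, h₁⟩ := exists_eq_add_const_of_deriv_eq isPreconnected_Ioo isOpen_Ioo
    subset_rfl subset_closure hsub hφ (hpow C m)
    fun x hx => by rw [hφ' x hx, deriv_const_mul_rpow_div h0 hx.1]
  obtain ⟨B₂, h₂⟩ := exists_eq_add_const_of_deriv_eq isPreconnected_Ioo isOpen_Ioo
    subset_rfl subset_closure hsub hχ (hpow C⁻¹ (1 - m)) fun x hx => by
      rw [hχ' x hx, deriv_const_mul_rpow_div h1 hx.1]
      congr 2
      ring
  have key : ∀ x : ℝ, 1 < x →
      (x ^ m - 1) / m * ((x ^ (1 - m) - 1) / (1 - m)) ≤ (x - 1) ^ 2 := by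
    intro x hx
    have hx0 : 0 < x := by linarith
    set y := 1 / (2 * (x + 1)) with hy
    have hy0 : 0 < y := by positivity
    have hxy : x * y + y < 1 := by
      have : x * y + y = 1 / 2 := by rw [hy]; field_simp
      linarith
    have hxy0 : 0 < x * y := by positivity
    have h := sub_mul_sub_eq_of_dslope hy0 (hfun (x * y) y hxy0 hy0 hxy)
    rw [h₁ _ ⟨hxy0, by linarith⟩, h₁ y ⟨hy0, by linarith⟩, h₂ _ ⟨hxy0, by linarith⟩,
      h₂ y ⟨hy0, by linarith⟩, mul_div_assoc, div_self hy0.ne', mul_one,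
      Real.mul_rpow hx0.le hy0.le, Real.mul_rpow hx0.le hy0.le] at h
    have hyy : y ^ m * y ^ (1 - m) = y := by
      rw [← Real.rpow_add hy0]
      simp
    have hf1 : 1 ≤ f x := by
      have := hf.operatorMonotone.le_of_le one_pos hx.le
      rwa [hf.normalised] at this
    have h3 : (x ^ m - 1) / m * ((x ^ (1 - m) - 1) / (1 - m)) = (x - 1) ^ 2 / f x := by
      refine mul_left_cancel₀ hy0.ne' ?_
      rw [← h]
      nth_rewrite 1 [← hyy]
      field_simp
      ring
    rw [h3]
    exact div_le_self (sq_nonneg _) hf1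
  refine ⟨?_, le_two_of_forall_rpow_le key⟩
  have := le_two_of_forall_rpow_le (m := 1 - m) fun x hx => by
    rw [sub_sub_cancel, mul_comm]
    exact key x hx
  linarith

theorem isWYDPairOn_Ioi_of_dslope_eq {φ χ f : ℝ → ℝ}
    (hf : IsNormalisedSymmetricOperatorMonotone f)
    (hφ : ContDiffOn ℝ 1 φ (Ioi 0)) (hχ : ContDiffOn ℝ 1 χ (Ioi 0))
    (hprod : ∀ x, 0 < x → deriv φ x * deriv χ x = 1 / x)
    (hfun : ∀ x y, 0 < x → 0 < y → x ≠ y → dslope φ x y * dslope χ x y = cmFunction f x y) :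
    IsWYDPairOn (Ioi 0) φ χ := by
  obtain ⟨m, C, h⟩ := deriv_eq_of_dslope_eq (f := f) one_lt_two ordConnected_Ioi isOpen_Ioi
    subset_rfl
    (fun y hy => mem_Ioi.2 (half_pos (mem_Ioi.1 hy))) hφ hχ (fun _ _ x hx => hprod x hx.1)
    fun y hy => by
      filter_upwards [Ioi_mem_nhds (show 0 < 2 * y from mul_pos two_pos hy)] with x hx
      exact hfun x y hx hy
  have h' : ∀ x ∈ Ioi (0 : ℝ), deriv φ x = C * x ^ (m - 1) := fun x hx => by
    have := h (x / 2) (mem_Ioi.2 (half_pos (mem_Ioi.1 hx)))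
    rwa [mul_div_cancel₀ _ two_ne_zero] at this
  have hC : C ≠ 0 := by
    rintro rfl
    have := hprod 1 one_pos
    rw [h' 1 (mem_Ioi.2 one_pos)] at this
    norm_num at this
  have hχ' : ∀ x ∈ Ioi (0 : ℝ), deriv χ x = C⁻¹ * x ^ (-m) := fun x hx => by
    have h1 := hprod x hx
    have hx0 : (0 : ℝ) < x := hx
    rw [h' x hx, Real.rpow_sub_one hx0.ne'] at h1
    have := (Real.rpow_pos_of_pos hx0 m).ne'
    rw [Real.rpow_neg hx0.le]
    field_simp at h1 ⊢
    linarith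
  exact isWYDPairOn_of_deriv_eq isPreconnected_Ioi isOpen_Ioi subset_rfl subset_closure subset_rfl
    (hφ.differentiableOn one_ne_zero) (hχ.differentiableOn one_ne_zero) hC h' hχ'
    (mem_Icc_of_deriv_eq_rpow hf (hφ.differentiableOn one_ne_zero) (hχ.differentiableOn one_ne_zero)
      hC (fun x hx => h' x hx.1) (fun x hx => hχ' x hx.1) fun x y hx hy _ => hfun x y hx hy)

/-- For a ratio `r` the pairs `(r y, y)` with `(r + 1) y < 1` determine `φ'` on
`(0, r / (r + 1))`; as `r` grows these intervals exhaust `(0, 1)`, and the parameters agree on the overlaps. -/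
theorem isWYDPairOn_Ioc_of_dslope_eq {φ χ f : ℝ → ℝ}
    (hf : IsNormalisedSymmetricOperatorMonotone f)
    (hφ : ContDiffOn ℝ 1 φ (Ioi 0)) (hχ : ContDiffOn ℝ 1 χ (Ioi 0))
    (hprod : ∀ x, 0 < x → x < 1 → deriv φ x * deriv χ x = 1 / x)
    (hfun : ∀ x y, 0 < x → 0 < y → x + y < 1 → x ≠ y →
      dslope φ x y * dslope χ x y = cmFunction f x y) :
    IsWYDPairOn (Ioc 0 1) φ χ := by
  have hr : ∀ r : ℝ, 1 < r → ∃ m C : ℝ, ∀ x, 0 < x → (r + 1) * x < r →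
      deriv φ x = C * x ^ (m - 1) := by
    intro r hr
    have hr0 : 0 < r := by linarith
    obtain ⟨m, C, h⟩ := deriv_eq_of_dslope_eq (f := f) hr (s := Ioo 0 (1 / (r + 1)))
      ordConnected_Ioo isOpen_Ioo (fun x hx => hx.1)
      (fun y hy => ⟨div_pos hy.1 hr0, (div_le_self hy.1.le hr.le).trans_lt hy.2⟩)
      hφ hχ (fun y hy x hx => hprod x hx.1 (by
        have := hy.2
        rw [lt_div_iff₀ (by linarith)] at this
        nlinarith [hx.2, hy.1])) fun y hy => by
      have h1 : r * y + y < 1 := by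
        have := hy.2
        rw [lt_div_iff₀ (by linarith)] at this
        linarith
      filter_upwards [Ioi_mem_nhds (mul_pos hr0 hy.1),
        Iio_mem_nhds (show r * y < 1 - y by linarith)] with x hx hx'
      exact hfun x y hx hy.1 (by rw [mem_Iio] at hx'; linarith)
    refine ⟨m, C, fun x hx hx' => ?_⟩
    have := h (x / r) ⟨div_pos hx hr0, by
      rw [div_lt_div_iff₀ hr0 (by linarith)]
      linarith⟩
    rwa [mul_div_cancel₀ _ hr0.ne'] at this
  obtain ⟨m, C, h⟩ := hr 2 one_lt_two
  have hC : C ≠ 0 := by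
    rintro rfl
    have := hprod (1 / 2) (by norm_num) (by norm_num)
    rw [h (1 / 2) (by norm_num) (by norm_num)] at this
    norm_num at this
  have h' : ∀ x ∈ Ioo (0 : ℝ) 1, deriv φ x = C * x ^ (m - 1) := by
    intro x hx
    -- any ratio `r ≥ 2` with `x < r / (r + 1)` will do
    have hr1 : 0 < 1 - x := sub_pos.2 hx.2
    have hr2 : 1 < 2 + 1 / (1 - x) := by
      have : 0 < 1 / (1 - x) := by positivity
      linarith
    obtain ⟨m', C', h2⟩ := hr (2 + 1 / (1 - x)) hr2
    have hlt : ∀ z, 0 < z → z ≤ 1 / 2 → (2 + 1 / (1 - x) + 1) * z < 2 + 1 / (1 - x) := by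
      intro z hz hz'
      nlinarith
    have e2 := (h (1 / 2) (by norm_num) (by norm_num)).symm.trans
      (h2 (1 / 2) (by norm_num) (hlt _ (by norm_num) (by norm_num)))
    have e4 := (h (1 / 4) (by norm_num) (by norm_num)).symm.trans
      (h2 (1 / 4) (by norm_num) (hlt _ (by norm_num) (by norm_num)))
    obtain ⟨rfl, rfl⟩ := rpow_sub_one_params_eq hC e2 e4
    refine h2 x hx.1 ?_
    have : 1 / (1 - x) * (1 - x) = 1 := by field_simp
    nlinarith [hx.1]
  have hχ' : ∀ x ∈ Ioo (0 : ℝ) 1, deriv χ x = C⁻¹ * x ^ (-m) := fun x hx => by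
    have h1 := hprod x hx.1 hx.2
    have hx0 : (0 : ℝ) < x := hx.1
    rw [h' x hx, Real.rpow_sub_one hx0.ne'] at h1
    have := (Real.rpow_pos_of_pos hx0 m).ne'
    rw [Real.rpow_neg hx0.le]
    field_simp at h1 ⊢
    linarith
  refine isWYDPairOn_of_deriv_eq isPreconnected_Ioo isOpen_Ioo Ioo_subset_Ioc_self ?_
    (fun x hx => hx.1)
    (hφ.differentiableOn one_ne_zero) (hχ.differentiableOn one_ne_zero) hC h' hχ'
    (mem_Icc_of_deriv_eq_rpow hf (hφ.differentiableOn one_ne_zero) (hχ.differentiableOn one_ne_zero)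
      hC h' hχ' hfun)
  rw [closure_Ioo zero_ne_one]
  exact Ioc_subset_Icc_self

theorem isWYDPairOn_Ioi_of_inducesPairedMonotoneMetric {φ χ : ℝ → ℝ}
    (hφ : ContDiffOn ℝ 1 φ (Ioi 0)) (hχ : ContDiffOn ℝ 1 χ (Ioi 0))
    (h : InducesPairedMonotoneMetric φ χ) : IsWYDPairOn (Ioi 0) φ χ := by
  obtain ⟨f, hf, h⟩ := h
  have hdφ := hφ.differentiableOn one_ne_zero
  have hdχ := hχ.differentiableOn one_ne_zero
  refine isWYDPairOn_Ioi_of_dslope_eq hf hφ hχ (fun x hx => ?_) fun x y hx hy hxy => ?_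
  · have hpos : ∀ i, 0 < (fun _ : Fin 3 => x) i := fun _ => hx
    have := deriv_mul_deriv_eq_cmFunction (posDef_diagonal_ofReal hpos) le_rfl hdφ hdχ
      (fun A B hA _ hB _ => h _ _ (posDef_diagonal_ofReal hpos) A B hA hB)
      (mem_spectrum_diagonal _ 0)
    rw [this, cmFunction, mul_inv_cancel₀ hx.ne', hf.normalised, mul_one]
  · have hpos : ∀ i, 0 < ![x, y] i := by
      intro i
      fin_cases i
      · exact hx
      · exact hy
    exact dslope_mul_dslope_eq_cmFunction (posDef_diagonal_ofReal hpos) hdφ hdχ hf.symmetric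
      (fun A B hA _ hB _ => h _ _ (posDef_diagonal_ofReal hpos) A B hA hB)
      (mem_spectrum_diagonal _ 0)
      (mem_spectrum_diagonal _ 1) hxy

/-- The `3 × 3` densities with eigenvalues `x, y, 1 - x - y` give all pairs with `x + y < 1`. -/
theorem isWYDPairOn_Ioc_of_inducesPairedMonotoneMetricOnDensities {φ χ : ℝ → ℝ}
    (hφ : ContDiffOn ℝ 1 φ (Ioi 0)) (hχ : ContDiffOn ℝ 1 χ (Ioi 0))
    (h : InducesPairedMonotoneMetricOnDensities φ χ) : IsWYDPairOn (Ioc 0 1) φ χ := by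
  obtain ⟨f, hf, h⟩ := h
  have hdφ := hφ.differentiableOn one_ne_zero
  have hdχ := hχ.differentiableOn one_ne_zero
  have hpos : ∀ x y z : ℝ, 0 < x → 0 < y → 0 < z → ∀ i, 0 < ![x, y, z] i := by
    intro x y z hx hy hz i
    fin_cases i
    · exact hx
    · exact hy
    · exact hz
  have htr : ∀ x y z : ℝ, x + y + z = 1 →
      (Matrix.diagonal fun k => ((![x, y, z] k : ℝ) : ℂ)).trace = 1 := by
    intro x y z hxyz
    rw [trace_diagonal, Fin.sum_univ_three]
    exact_mod_cast hxyz
  refine isWYDPairOn_Ioc_of_dslope_eq hf hφ hχ (fun x hx hx1 => ?_) fun x y hx hy hxy1 hxy => ?_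
  · have hp := hpos x ((1 - x) / 2) ((1 - x) / 2) hx (by linarith) (by linarith)
    have := deriv_mul_deriv_eq_cmFunction (posDef_diagonal_ofReal hp) le_rfl hdφ hdχ
      (fun A B hA hA0 hB hB0 => h _ _ (posDef_diagonal_ofReal hp) (htr _ _ _ (by ring))
        A B hA hA0 hB hB0)
      (mem_spectrum_diagonal _ 0)
    change deriv φ x * deriv χ x = cmFunction f x x at this
    rw [this, cmFunction, mul_inv_cancel₀ hx.ne', hf.normalised, mul_one]
  · have hp := hpos x y (1 - x - y) hx hy (by linarith)
    exact dslope_mul_dslope_eq_cmFunction (posDef_diagonal_ofReal hp) hdφ hdχ hf.symmetric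
      (fun A B hA hA0 hB hB0 => h _ _ (posDef_diagonal_ofReal hp) (htr _ _ _ (by ring))
        A B hA hA0 hB hB0)
      (mem_spectrum_diagonal _ 0) (mem_spectrum_diagonal _ 1) hxy

/-! ### Operator antitone functions and their mixtures -/

open MeasureTheory

/-- `g` is operator antitone on `(0,∞)`: `0 < A ≤ B` implies `g(B) ≤ g(A)` for complex matrices of
every size. No sign is required of `g`. -/
def IsOperatorAntitone (g : ℝ → ℝ) : Prop :=
  ∀ (n : ℕ) (A B : Matrix (Fin n) (Fin n) ℂ), A.PosDef → B.PosDef → (B - A).PosSemidef →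
    (cfc g A - cfc g B).PosSemidef

section InverseAntitone

open scoped Matrix.Norms.L2Operator MatrixOrder

theorem Matrix.PosDef.inv_sub_inv_posSemidef {n : ℕ} {A B : Matrix (Fin n) (Fin n) ℂ}
    (hA : A.PosDef) (hB : B.PosDef) (h : (B - A).PosSemidef) : (A⁻¹ - B⁻¹).PosSemidef := by
  have h1 := CStarAlgebra.inv_le_inv (a := hA.isUnit.unit) (b := hB.isUnit.unit)
    hA.posSemidef.nonneg (Matrix.le_iff.2 h)
  rw [Matrix.coe_units_inv, Matrix.coe_units_inv] at h1
  exact Matrix.le_iff.1 h1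

end InverseAntitone

theorem continuousOn_spectrum {n : ℕ} {A : Matrix (Fin n) (Fin n) ℂ} (hA : A.IsHermitian)
    (g : ℝ → ℝ) : ContinuousOn g (spectrum ℝ A) := by
  refine Set.Finite.continuousOn ?_ g
  rw [hA.spectrum_real_eq_range_eigenvalues]
  exact Set.finite_range _

theorem posDef_cfc {n : ℕ} {A : Matrix (Fin n) (Fin n) ℂ} (hA : A.IsHermitian) {g : ℝ → ℝ}
    (hg : ∀ x ∈ spectrum ℝ A, 0 < g x) : (cfc g A).PosDef := by
  rw [cfc_eq_conj_diagonal hA]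
  refine (posDef_diagonal_ofReal fun i =>
    hg _ (eigenvalues_mem_spectrum hA i)).mul_mul_conjTranspose_same ?_
  refine vecMul_injective_of_isUnit ?_
  exact (Unitary.toUnits hA.eigenvectorUnitary).isUnit

theorem inv_cfc {n : ℕ} {A : Matrix (Fin n) (Fin n) ℂ} (hA : A.IsHermitian) {g : ℝ → ℝ}
    (hg : ∀ x ∈ spectrum ℝ A, 0 < g x) : (cfc g A)⁻¹ = cfc (fun x => 1 / g x) A := by
  refine Matrix.inv_eq_left_inv ?_
  rw [← cfc_mul _ _ A (continuousOn_spectrum hA _) (continuousOn_spectrum hA _),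
    cfc_congr (g := fun _ => 1) fun x hx => one_div_mul_cancel (hg x hx).ne']
  exact cfc_const_one ℝ A hA.isSelfAdjoint

theorem IsOperatorAntitone.isOperatorMonotone_one_div {g : ℝ → ℝ} (hg : IsOperatorAntitone g)
    (hpos : ∀ x, 0 < x → 0 < g x) : IsOperatorMonotone fun x => 1 / g x := by
  intro n A B hA hB hAB
  have hp : ∀ {C : Matrix (Fin n) (Fin n) ℂ}, C.PosDef → ∀ x ∈ spectrum ℝ C, 0 < g x :=
    fun hC x hx => hpos x (pos_of_mem_spectrum_of_posDef hC hx)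
  have hpA := posDef_cfc hA.isHermitian (hp hA)
  have hpB := posDef_cfc hB.isHermitian (hp hB)
  rw [← inv_cfc hA.isHermitian (hp hA), ← inv_cfc hB.isHermitian (hp hB)]
  exact ⟨hpA.inv.posSemidef, hpB.inv_sub_inv_posSemidef hpA (hg n A B hA hB hAB)⟩

theorem isOperatorAntitone_one_div_affine {a b : ℝ} (ha : 0 ≤ a) (hb : 0 ≤ b) (hab : 0 < a + b) :
    IsOperatorAntitone fun x => 1 / (a * x + b) := by
  intro n A B hA hB hAB
  have hp : ∀ {C : Matrix (Fin n) (Fin n) ℂ}, C.PosDef → ∀ x ∈ spectrum ℝ C, 0 < a * x + b := by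
    intro C hC x hx
    have hx0 := pos_of_mem_spectrum_of_posDef hC hx
    rcases ha.eq_or_lt with rfl | ha
    · linarith
    · positivity
  have haff : ∀ {C : Matrix (Fin n) (Fin n) ℂ}, C.PosDef →
      cfc (fun x : ℝ => a * x + b) C = a • C + algebraMap ℝ _ b := by
    intro C hC
    rw [cfc_add_const b (fun x => a * x) C (continuousOn_spectrum hC.isHermitian _)
      hC.isHermitian.isSelfAdjoint, cfc_const_mul_id a C hC.isHermitian.isSelfAdjoint]
  rw [← inv_cfc hA.isHermitian (hp hA), ← inv_cfc hB.isHermitian (hp hB)]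
  refine (posDef_cfc hA.isHermitian (hp hA)).inv_sub_inv_posSemidef
    (posDef_cfc hB.isHermitian (hp hB)) ?_
  rw [haff hA, haff hB, add_sub_add_right_eq_sub, ← smul_sub]
  exact hAB.smul ha

theorem IsOperatorAntitone.congr {g g' : ℝ → ℝ} (hg : IsOperatorAntitone g)
    (h : ∀ x, 0 < x → g x = g' x) : IsOperatorAntitone g' := by
  intro n A B hA hB hAB
  have hc : ∀ {C : Matrix (Fin n) (Fin n) ℂ}, C.PosDef → cfc g' C = cfc g C := fun hC =>
    cfc_congr fun x hx => (h x (pos_of_mem_spectrum_of_posDef hC hx)).symm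
  rw [hc hA, hc hB]
  exact hg n A B hA hB hAB

theorem IsOperatorAntitone.add {g g' : ℝ → ℝ} (hg : IsOperatorAntitone g)
    (hg' : IsOperatorAntitone g') : IsOperatorAntitone fun x => g x + g' x := by
  intro n A B hA hB hAB
  have hc : ∀ {C : Matrix (Fin n) (Fin n) ℂ}, C.PosDef →
      cfc (fun x => g x + g' x) C = cfc g C + cfc g' C := fun hC =>
    cfc_add _ _ _ (continuousOn_spectrum hC.isHermitian _) (continuousOn_spectrum hC.isHermitian _)
  rw [hc hA, hc hB, add_sub_add_comm]
  exact (hg n A B hA hB hAB).add (hg' n A B hA hB hAB)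

theorem IsOperatorAntitone.const_mul {g : ℝ → ℝ} (hg : IsOperatorAntitone g) {c : ℝ} (hc : 0 ≤ c) :
    IsOperatorAntitone fun x => c * g x := by
  intro n A B hA hB hAB
  have hm : ∀ {C : Matrix (Fin n) (Fin n) ℂ}, C.PosDef →
      cfc (fun x => c * g x) C = c • cfc g C := fun hC =>
    cfc_const_mul _ _ _ (continuousOn_spectrum hC.isHermitian _)
  rw [hm hA, hm hB, ← smul_sub]
  exact (hg n A B hA hB hAB).smul hc

/-- The quadratic form of `g(A)` is a combination of the values of `g` on the spectrum of `A`,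
with weights that do not depend on `g`. -/
theorem exists_weights_quadraticForm_cfc {n : ℕ} {A : Matrix (Fin n) (Fin n) ℂ}
    (hA : A.IsHermitian) (v : Fin n → ℂ) : ∃ w : Fin n → ℝ, ∀ g : ℝ → ℝ,
      star v ⬝ᵥ (cfc g A *ᵥ v) = ((∑ i, g (hA.eigenvalues i) * w i : ℝ) : ℂ) := by
  set U := (hA.eigenvectorUnitary : Matrix (Fin n) (Fin n) ℂ) with hU
  refine ⟨fun i => Complex.normSq ((Uᴴ *ᵥ v) i), fun g => ?_⟩
  rw [cfc_eq_conj_diagonal hA, ← hU, ← mulVec_mulVec, ← mulVec_mulVec, dotProduct_mulVec,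
    ← star_star (star v ᵥ* U), star_vecMul, star_star, dotProduct]
  push_cast
  refine Finset.sum_congr rfl fun i _ => ?_
  rw [mulVec_diagonal, Pi.star_apply, Complex.normSq_eq_conj_mul_self]
  simp only [Complex.star_def]
  ring

theorem isOperatorAntitone_integral {α : Type*} [MeasurableSpace α] {μ : Measure α} {G : α → ℝ → ℝ}
    (hG : ∀ᵐ t ∂μ, IsOperatorAntitone (G t)) (hint : ∀ x, 0 < x → Integrable (fun t => G t x) μ) :
    IsOperatorAntitone fun x => ∫ t, G t x ∂μ := by
  intro n A B hA hB hAB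
  refine PosSemidef.of_dotProduct_mulVec_nonneg ?_ fun v => ?_
  · exact IsHermitian.sub (cfc_predicate (p := IsSelfAdjoint) _ A)
      (cfc_predicate (p := IsSelfAdjoint) _ B)
  obtain ⟨w, hw⟩ := exists_weights_quadraticForm_cfc hA.isHermitian v
  obtain ⟨w', hw'⟩ := exists_weights_quadraticForm_cfc hB.isHermitian v
  have hi : ∀ {C : Matrix (Fin n) (Fin n) ℂ} (hC : C.PosDef) (w : Fin n → ℝ) (i : Fin n),
      Integrable (fun t => G t (hC.isHermitian.eigenvalues i) * w i) μ := fun hC w i =>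
    (hint _ (hC.eigenvalues_pos i)).mul_const _
  have hI : ∀ {C : Matrix (Fin n) (Fin n) ℂ} (hC : C.PosDef) (w : Fin n → ℝ),
      ∑ i, (∫ t, G t (hC.isHermitian.eigenvalues i) ∂μ) * w i =
        ∫ t, ∑ i, G t (hC.isHermitian.eigenvalues i) * w i ∂μ := by
    intro C hC w
    rw [integral_finsetSum _ fun i _ => hi hC w i]
    simp only [integral_mul_const]
  rw [sub_mulVec, dotProduct_sub, hw, hw', ← Complex.ofReal_sub, hI hA, hI hB]
  refine Complex.zero_le_real.2 (sub_nonneg.2 (integral_mono_ae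
    (integrable_finsetSum _ fun i _ => hi hB w' i)
    (integrable_finsetSum _ fun i _ => hi hA w i) ?_))
  filter_upwards [hG] with t ht
  have h := (ht n A B hA hB hAB).dotProduct_mulVec_nonneg v
  rw [sub_mulVec, dotProduct_sub, hw, hw', ← Complex.ofReal_sub] at h
  exact sub_nonneg.1 (Complex.zero_le_real.1 h)

/-- An antitone function that agrees off `a` with a function continuous at `a` agrees with it at
`a`. -/
theorem AntitoneOn.eq_of_continuousAt {G g : ℝ → ℝ} (hG : AntitoneOn G (Ioi 0)) {a : ℝ} (ha : 0 < a)
    (hg : ContinuousAt g a) (h : ∀ x, 0 < x → x ≠ a → G x = g x) : G a = g a := by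
  refine le_antisymm ?_ ?_
  · refine ge_of_tendsto (hg.tendsto.mono_left nhdsWithin_le_nhds : Filter.Tendsto g (𝓝[<] a) _) ?_
    filter_upwards [self_mem_nhdsWithin, nhdsWithin_le_nhds (Ioi_mem_nhds ha)] with x hx hx0
    rw [← h x hx0 (ne_of_lt hx)]
    exact hG hx0 (mem_Ioi.2 ha) (le_of_lt hx)
  · refine le_of_tendsto (hg.tendsto.mono_left nhdsWithin_le_nhds : Filter.Tendsto g (𝓝[>] a) _) ?_
    filter_upwards [self_mem_nhdsWithin, nhdsWithin_le_nhds (Ioi_mem_nhds ha)] with x hx hx0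
    rw [← h x hx0 (ne_of_gt hx)]
    exact hG (mem_Ioi.2 ha) hx0 (le_of_lt hx)

/-- The kernel `1 / (x + t) + 1 / (t x + 1)`, both summands in the form `1 / (a x + b)`. -/
noncomputable def symmetricKernel (t x : ℝ) : ℝ := 1 / (1 * x + t) + 1 / (t * x + 1)

theorem symmetricKernel_nonneg {t x : ℝ} (ht : 0 ≤ t) (hx : 0 ≤ x) : 0 ≤ symmetricKernel t x := by
  unfold symmetricKernel
  positivity

theorem symmetricKernel_anti {t x y : ℝ} (ht : 0 ≤ t) (hx : 0 < x) (hxy : x ≤ y) :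
    symmetricKernel t y ≤ symmetricKernel t x := by
  unfold symmetricKernel
  gcongr

theorem isOperatorAntitone_symmetricKernel {t : ℝ} (ht : 0 ≤ t) :
    IsOperatorAntitone (symmetricKernel t) :=
  (isOperatorAntitone_one_div_affine zero_le_one ht (by linarith)).add
    (isOperatorAntitone_one_div_affine ht zero_le_one (by linarith))

/-- The representation is only required off `x = 1`, where divided differences are explicit. -/
theorem isOperatorAntitone_of_eq_integral_symmetricKernel {w g : ℝ → ℝ}
    (hw : ∀ t, 0 < t → 0 ≤ w t) (hwc : ContinuousOn w (Ioi 0))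
    (hint : ∀ x, 0 < x → x ≠ 1 → IntegrableOn (fun t => w t * symmetricKernel t x) (Ioi 0))
    (h : ∀ x, 0 < x → x ≠ 1 → ∫ t in Ioi 0, w t * symmetricKernel t x = g x)
    (hg : ContinuousAt g 1) : IsOperatorAntitone g := by
  have hint' : ∀ x, 0 < x → IntegrableOn (fun t => w t * symmetricKernel t x) (Ioi 0) := by
    intro x hx
    rcases eq_or_ne x 1 with rfl | hx1
    · refine (((hint 2 two_pos (by norm_num)).const_mul 2).mono' ?_ ?_)
      · refine ContinuousOn.aestronglyMeasurable (hwc.mul ?_) measurableSet_Ioi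
        unfold symmetricKernel
        refine ContinuousOn.add (ContinuousOn.div (by fun_prop) (by fun_prop) fun t ht => ?_)
          (ContinuousOn.div (by fun_prop) (by fun_prop) fun t ht => ?_) <;>
        · rw [mem_Ioi] at ht
          positivity
      · filter_upwards [ae_restrict_mem measurableSet_Ioi] with t ht
        rw [mem_Ioi] at ht
        rw [Real.norm_of_nonneg (mul_nonneg (hw t ht) (symmetricKernel_nonneg ht.le zero_le_one)),
          mul_left_comm]
        refine mul_le_mul_of_nonneg_left ?_ (hw t ht)
        unfold symmetricKernel
        rw [mul_add]
        refine add_le_add ?_ ?_ <;>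
        · rw [mul_one_div, div_le_div_iff₀ (by positivity) (by positivity)]
          linarith
    · exact hint x hx hx1
  have hanti : AntitoneOn (fun x => ∫ t in Ioi 0, w t * symmetricKernel t x) (Ioi 0) := by
    intro x hx y hy hxy
    refine integral_mono_ae (hint' y hy) (hint' x hx) ?_
    filter_upwards [ae_restrict_mem measurableSet_Ioi] with t ht
    exact mul_le_mul_of_nonneg_left (symmetricKernel_anti (le_of_lt ht) hx hxy) (hw t ht)
  refine (isOperatorAntitone_integral (μ := volume.restrict (Ioi 0))
    (G := fun t x => w t * symmetricKernel t x) ?_ hint').congr fun x hx => ?_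
  · filter_upwards [ae_restrict_mem measurableSet_Ioi] with t ht
    exact (isOperatorAntitone_symmetricKernel (le_of_lt ht)).const_mul (hw t ht)
  · rcases eq_or_ne x 1 with rfl | hx1
    · exact hanti.eq_of_continuousAt one_pos hg h
    · exact h x hx hx1

/-! ### The standard pairs and their operator monotone functions -/

/-- The integral representation of `x ^ q` minus the same at `x = 1`. -/
theorem exists_rpow_sub_one_eq_integral {q : ℝ} (hq : q ∈ Ioo (0 : ℝ) 1) :
    ∃ c : ℝ, 0 < c ∧ ∀ x, 0 < x →
    IntegrableOn (fun t => t ^ q * (x - 1) / ((t + 1) * (t + x))) (Ioi 0) ∧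
    x ^ q - 1 = c * ∫ t in Ioi 0, t ^ q * (x - 1) / ((t + 1) * (t + x)) := by
  have hpos := Real.integral_rpowIntegrand₀₁_one_pos hq
  refine ⟨_, inv_pos.2 hpos, fun x hx => ?_⟩
  have hi := (Real.integrableOn_rpowIntegrand₀₁_Ioi hq hx.le).sub
    (Real.integrableOn_rpowIntegrand₀₁_Ioi hq zero_le_one)
  have heq : EqOn ((fun t => Real.rpowIntegrand₀₁ q t x) - fun t => Real.rpowIntegrand₀₁ q t 1)
      (fun t => t ^ q * (x - 1) / ((t + 1) * (t + x))) (Ioi 0) := by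
    intro t ht
    rw [mem_Ioi] at ht
    simp only [Pi.sub_apply, Real.rpowIntegrand₀₁]
    field_simp
    ring
  refine ⟨hi.congr_fun heq measurableSet_Ioi, ?_⟩
  rw [← setIntegral_congr_fun measurableSet_Ioi heq, integral_sub'
    (Real.integrableOn_rpowIntegrand₀₁_Ioi hq hx.le)
    (Real.integrableOn_rpowIntegrand₀₁_Ioi hq zero_le_one), mul_sub,
    ← Real.rpow_eq_const_mul_integral hq hx.le, inv_mul_cancel₀ hpos.ne']

/-- The integral representation of the powers turns a combination of `x ^ q - 1` and `x⁻¹ ^ q - 1`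
into an integral; `hk` asks that the integrand be `(x - 1) ^ 2` times a nonnegative multiple of
the kernel. -/
theorem isOperatorAntitone_of_rpow_combination {q C : ℝ} (hq : q ∈ Ioo (0 : ℝ) 1) (hC : 0 ≤ C)
    {a b w g : ℝ → ℝ} (hg : ContinuousAt g 1)
    (hw : ∀ t, 0 < t → 0 ≤ w t) (hwc : ContinuousOn w (Ioi 0))
    (hgx : ∀ x, 0 < x → g x * (x - 1) ^ 2 =
      C * (a x * (x ^ q - 1) + b x * (x⁻¹ ^ q - 1)))
    (hk : ∀ x t, 0 < x → 0 < t →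
      a x * (t ^ q * (x - 1) / ((t + 1) * (t + x))) +
        b x * (t ^ q * (x⁻¹ - 1) / ((t + 1) * (t + x⁻¹))) =
      (x - 1) ^ 2 * (w t * symmetricKernel t x)) : IsOperatorAntitone g := by
  obtain ⟨c, hc, h⟩ := exists_rpow_sub_one_eq_integral hq
  have hi : ∀ x, 0 < x →
      IntegrableOn (fun t => (x - 1) ^ 2 * (w t * symmetricKernel t x)) (Ioi 0) :=
    fun x hx => IntegrableOn.congr_fun (((h x hx).1.const_mul (a x)).add
      ((h x⁻¹ (inv_pos.2 hx)).1.const_mul (b x))) (fun t ht => hk x t hx ht) measurableSet_Ioi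
  have hcc : 0 ≤ C * c := mul_nonneg hC hc.le
  refine isOperatorAntitone_of_eq_integral_symmetricKernel (w := fun t => C * c * w t)
    (fun t ht => mul_nonneg hcc (hw t ht)) (continuousOn_const.mul hwc) (fun x hx hx1 => ?_)
    (fun x hx hx1 => ?_) hg
  · have h0 : (x - 1) ^ 2 ≠ 0 := pow_ne_zero 2 (sub_ne_zero.2 hx1)
    refine IntegrableOn.congr_fun ((hi x hx).const_mul (C * c / (x - 1) ^ 2)) (fun t _ => ?_)
      measurableSet_Ioi
    field_simp
  · have h0 : (x - 1) ^ 2 ≠ 0 := pow_ne_zero 2 (sub_ne_zero.2 hx1)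
    have e : ∫ t in Ioi 0, (x - 1) ^ 2 * (w t * symmetricKernel t x) =
        a x * (∫ t in Ioi 0, t ^ q * (x - 1) / ((t + 1) * (t + x))) +
        b x * (∫ t in Ioi 0, t ^ q * (x⁻¹ - 1) / ((t + 1) * (t + x⁻¹))) := by
      rw [← integral_const_mul, ← integral_const_mul, ← integral_add ((h x hx).1.const_mul _)
        ((h x⁻¹ (inv_pos.2 hx)).1.const_mul _)]
      exact setIntegral_congr_fun measurableSet_Ioi fun t ht => (hk x t hx ht).symm
    refine mul_right_cancel₀ h0 ?_
    rw [hgx x hx, (h x hx).2, (h x⁻¹ (inv_pos.2 hx)).2]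
    simp only [mul_assoc (C * c), integral_const_mul] at e ⊢
    linear_combination C * c * e

theorem dslope_one_mul_sq {φ χ : ℝ → ℝ} (x : ℝ) :
    dslope φ 1 x * dslope χ 1 x * (x - 1) ^ 2 = (φ x - φ 1) * (χ x - χ 1) := by
  rw [← sub_smul_dslope φ, ← sub_smul_dslope χ, smul_eq_mul, smul_eq_mul]
  ring

/-- A pair of functions with derivatives `x ^ (p - 1)` and `x ^ (-p)` on `(0,∞)`. This treats the
power pairs and the logarithmic pairs (`p = 0` and `p = 1`) alike. -/
structure IsPowerPair (p : ℝ) (φ χ : ℝ → ℝ) : Prop where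
  hasDerivAt_fst : ∀ x, 0 < x → HasDerivAt φ (x ^ (p - 1)) x
  hasDerivAt_snd : ∀ x, 0 < x → HasDerivAt χ (x ^ (-p)) x

theorem IsPowerPair.swap {p : ℝ} {φ χ : ℝ → ℝ} (h : IsPowerPair p φ χ) : IsPowerPair (1 - p) χ φ :=
  ⟨fun x hx => by simpa using h.hasDerivAt_snd x hx,
    fun x hx => by simpa using h.hasDerivAt_fst x hx⟩

theorem hasDerivAt_rpow_div {p x : ℝ} (hp : p ≠ 0) (hx : 0 < x) :
    HasDerivAt (fun x : ℝ => x ^ p / p) (x ^ (p - 1)) x := by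
  refine ((Real.hasDerivAt_rpow_const (p := p) (Or.inl hx.ne')).div_const p).congr_deriv ?_
  field_simp

theorem isPowerPair_rpow {p : ℝ} (h0 : p ≠ 0) (h1 : p ≠ 1) :
    IsPowerPair p (fun x => x ^ p / p) (fun x => x ^ (1 - p) / (1 - p)) :=
  ⟨fun x hx => hasDerivAt_rpow_div h0 hx, fun x hx =>
    (hasDerivAt_rpow_div (sub_ne_zero.2 h1.symm) hx).congr_deriv (by congr 1; ring)⟩

theorem isPowerPair_id_log : IsPowerPair 1 (fun x => x) Real.log :=
  ⟨fun x _ => by simpa using hasDerivAt_id' x, fun x hx => by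
    rw [Real.rpow_neg_one]
    exact Real.hasDerivAt_log hx.ne'⟩

theorem dslope_pos {φ φ' : ℝ → ℝ} (h : ∀ x, 0 < x → HasDerivAt φ (φ' x) x)
    (h0 : ∀ x, 0 < x → 0 < φ' x) {x y : ℝ} (hx : 0 < x) (hy : 0 < y) : 0 < dslope φ x y := by
  rcases eq_or_ne y x with rfl | hxy
  · rw [dslope_same, (h _ hx).deriv]
    exact h0 _ hx
  · have hm : StrictMonoOn φ (Ioi 0) := strictMonoOn_of_deriv_pos (convex_Ioi 0)
      (fun z hz => (h z hz).continuousAt.continuousWithinAt) fun z hz => by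
        rw [interior_Ioi] at hz
        rw [(h z hz).deriv]
        exact h0 z hz
    rw [dslope_of_ne _ hxy]
    exact hm.slope_pos hx hy hxy.symm

/-- Divided differences of a function whose derivative is homogeneous of degree `p - 1`. -/
theorem dslope_mul_mul {φ : ℝ → ℝ} {p : ℝ} (h : ∀ x, 0 < x → HasDerivAt φ (x ^ (p - 1)) x)
    {x y r : ℝ} (hx : 0 < x) (hy : 0 < y) (hr : 0 < r) :
    dslope φ (r * x) (r * y) = r ^ (p - 1) * dslope φ x y := by
  rcases eq_or_ne y x with rfl | hxy
  · rw [dslope_same, dslope_same, (h _ hx).deriv, (h _ (mul_pos hr hx)).deriv,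
      Real.mul_rpow hr.le hx.le]
  · have hd : ∀ z ∈ Ioi (0 : ℝ), HasDerivAt (fun z => φ (r * z) - r ^ p * φ z) 0 z := by
      intro z hz
      have h1 : HasDerivAt (fun z => φ (r * z)) ((r * z) ^ (p - 1) * r) z :=
        HasDerivAt.comp z (h _ (mul_pos hr hz)) (by simpa using (hasDerivAt_id z).const_mul r)
      refine (h1.sub ((h z hz).const_mul (r ^ p))).congr_deriv ?_
      rw [Real.mul_rpow hr.le (le_of_lt hz), Real.rpow_sub_one hr.ne']
      field_simp
      ring
    obtain ⟨B, hB⟩ := isOpen_Ioi.exists_is_const_of_deriv_eq_zero isPreconnected_Ioi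
      (fun z hz => (hd z hz).differentiableAt.differentiableWithinAt) (fun z hz => (hd z hz).deriv)
    have e1 := hB x hx
    have e2 := hB y hy
    have hne : y - x ≠ 0 := sub_ne_zero.2 hxy
    rw [dslope_of_ne _ hxy, dslope_of_ne _ (by simpa [hr.ne'] using hxy), slope_def_field,
      slope_def_field, ← mul_sub, Real.rpow_sub_one hr.ne']
    field_simp
    linear_combination e2 - e1

theorem IsPowerPair.dslope_mul_dslope_mul_mul {p : ℝ} {φ χ : ℝ → ℝ} (h : IsPowerPair p φ χ)
    {x y r : ℝ} (hx : 0 < x) (hy : 0 < y) (hr : 0 < r) :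
    dslope φ (r * x) (r * y) * dslope χ (r * x) (r * y) = dslope φ x y * dslope χ x y / r := by
  rw [dslope_mul_mul h.hasDerivAt_fst hx hy hr,
    dslope_mul_mul (p := 1 - p) h.swap.hasDerivAt_fst hx hy hr, mul_mul_mul_comm,
    ← Real.rpow_add hr, show p - 1 + (1 - p - 1) = -1 by ring, Real.rpow_neg_one]
  ring

/-- Homogeneity recovers the product of divided differences from its values at `(1, x)`; their
reciprocal is the operator monotone function. -/
theorem IsPowerPair.exists_isNormalisedSymmetricOperatorMonotone {p : ℝ} {φ χ : ℝ → ℝ}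
    (h : IsPowerPair p φ χ) (ha : IsOperatorAntitone fun x => dslope φ 1 x * dslope χ 1 x) :
    ∃ f, IsNormalisedSymmetricOperatorMonotone f ∧ ∀ x y, 0 < x → 0 < y →
      dslope φ x y * dslope χ x y = cmFunction f x y := by
  have hpos : ∀ x, 0 < x → 0 < dslope φ 1 x * dslope χ 1 x := fun x hx =>
    mul_pos (dslope_pos h.hasDerivAt_fst (fun z hz => Real.rpow_pos_of_pos hz _) one_pos hx)
      (dslope_pos h.hasDerivAt_snd (fun z hz => Real.rpow_pos_of_pos hz _) one_pos hx)
  refine ⟨fun x => 1 / (dslope φ 1 x * dslope χ 1 x),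
    ⟨ha.isOperatorMonotone_one_div hpos, fun x hx => ?_, ?_⟩, fun x y hx hy => ?_⟩
  · have e := h.dslope_mul_dslope_mul_mul one_pos hx (inv_pos.2 hx)
    rw [mul_one, inv_mul_cancel₀ hx.ne', dslope_comm φ, dslope_comm χ] at e
    rw [e]
    have := (hpos x hx).ne'
    field_simp
  · simp only [dslope_same, (h.hasDerivAt_fst 1 one_pos).deriv, (h.hasDerivAt_snd 1 one_pos).deriv]
    simp
  · have e := h.dslope_mul_dslope_mul_mul one_pos (div_pos hx hy) hy
    rw [mul_one, mul_div_cancel₀ _ hy.ne', dslope_comm φ y, dslope_comm χ y] at e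
    rw [e, cmFunction, ← div_eq_mul_inv, mul_one_div, one_div_div]

theorem IsPowerPair.continuousAt_dslope {p : ℝ} {φ χ : ℝ → ℝ} (h : IsPowerPair p φ χ) :
    ContinuousAt (fun x => dslope φ 1 x * dslope χ 1 x) 1 :=
  (continuousAt_dslope_same.2 (h.hasDerivAt_fst 1 one_pos).differentiableAt).mul
    (continuousAt_dslope_same.2 (h.hasDerivAt_snd 1 one_pos).differentiableAt)

theorem isOperatorAntitone_dslope_rpow_of_mem_Ioo_zero_one {p : ℝ} (hp : p ∈ Ioo (0 : ℝ) 1) :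
    IsOperatorAntitone fun x => dslope (fun x => x ^ p / p) 1 x *
      dslope (fun x => x ^ (1 - p) / (1 - p)) 1 x := by
  have hp0 : p ≠ 0 := hp.1.ne'
  have hp1 : 1 - p ≠ 0 := (sub_pos.2 hp.2).ne'
  refine isOperatorAntitone_of_rpow_combination hp (C := 1 / (p * (1 - p)))
    (one_div_nonneg.2 (mul_nonneg hp.1.le (sub_pos.2 hp.2).le)) (a := fun _ => -1)
    (b := fun x => -x) (w := fun t => t ^ p / (t + 1) ^ 2)
    (isPowerPair_rpow hp0 hp.2.ne).continuousAt_dslope (fun t ht => by positivity) ?_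
    (fun x hx => ?_) fun x t hx ht => ?_
  · refine ContinuousOn.div (continuousOn_id.rpow_const fun t ht => Or.inl (ne_of_gt ht))
      (by fun_prop) fun t ht => ?_
    rw [mem_Ioi] at ht
    positivity
  · rw [dslope_one_mul_sq, Real.one_rpow, Real.one_rpow, Real.rpow_sub hx, Real.rpow_one,
      Real.inv_rpow hx.le]
    have := (Real.rpow_pos_of_pos hx p).ne'
    field_simp
    ring
  · simp only [symmetricKernel]
    field_simp
    ring

theorem isOperatorAntitone_dslope_rpow_of_mem_Ioo_one_two {p : ℝ} (hp : p ∈ Ioo (1 : ℝ) 2) :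
    IsOperatorAntitone fun x => dslope (fun x => x ^ p / p) 1 x *
      dslope (fun x => x ^ (1 - p) / (1 - p)) 1 x := by
  have hp0 : 0 < p := one_pos.trans hp.1
  have hp1 : 0 < p - 1 := sub_pos.2 hp.1
  have hp1' : 1 - p ≠ 0 := (sub_neg.2 hp.1).ne
  have hq : p - 1 ∈ Ioo (0 : ℝ) 1 := ⟨hp1, by linarith [hp.2]⟩
  refine isOperatorAntitone_of_rpow_combination hq (C := 1 / (p * (p - 1)))
    (one_div_nonneg.2 (mul_nonneg hp0.le hp1.le)) (a := fun x => x)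
    (b := fun _ => 1) (w := fun t => t ^ (p - 1) * t / (t + 1) ^ 2)
    (isPowerPair_rpow hp0.ne' hp.1.ne').continuousAt_dslope (fun t ht => by positivity) ?_
    (fun x hx => ?_) fun x t hx ht => ?_
  · refine ContinuousOn.div ((continuousOn_id.rpow_const fun t ht => Or.inl (ne_of_gt ht)).mul
      continuousOn_id) (by fun_prop) fun t ht => ?_
    rw [mem_Ioi] at ht
    positivity
  · rw [dslope_one_mul_sq, Real.one_rpow, Real.one_rpow, Real.rpow_sub hx, Real.rpow_sub_one hx.ne',
      Real.rpow_one, Real.inv_rpow hx.le, Real.rpow_sub_one hx.ne']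
    have := (Real.rpow_pos_of_pos hx p).ne'
    have := hp1.ne'
    field_simp
    ring
  · simp only [symmetricKernel]
    field_simp
    ring

theorem isOperatorAntitone_dslope_rpow_two :
    IsOperatorAntitone fun x => dslope (fun x : ℝ => x ^ (2 : ℝ) / 2) 1 x *
      dslope (fun x : ℝ => x ^ (1 - 2 : ℝ) / (1 - 2)) 1 x := by
  refine (((isOperatorAntitone_one_div_affine zero_le_one le_rfl (by norm_num)).add
    (isOperatorAntitone_one_div_affine le_rfl zero_le_one (by norm_num))).const_mul
    (one_half_pos (α := ℝ)).le).congr fun x hx => ?_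
  have hP := isPowerPair_rpow (p := 2) two_ne_zero (by norm_num)
  rcases eq_or_ne x 1 with rfl | hx1
  · rw [dslope_same, dslope_same, (hP.hasDerivAt_fst 1 one_pos).deriv,
      (hP.hasDerivAt_snd 1 one_pos).deriv]
    norm_num
  · have h0 := sub_ne_zero.2 hx1
    refine mul_right_cancel₀ (pow_ne_zero 2 h0) ?_
    rw [dslope_one_mul_sq, show (1 - 2 : ℝ) = -1 by norm_num, Real.rpow_neg_one, Real.rpow_two]
    field_simp
    norm_num
    ring

theorem isOperatorAntitone_dslope_id_log :
    IsOperatorAntitone fun x => dslope (fun x : ℝ => x) 1 x * dslope Real.log 1 x := by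
  have hpos : ∀ x : ℝ, 0 < x → ∀ s ∈ Icc (0 : ℝ) 1, 0 < s * x + (1 - s) := by
    intro x hx s hs
    rcases hs.1.eq_or_lt with rfl | h
    · norm_num
    · have := mul_pos h hx
      linarith [hs.2]
  have hcont : ∀ x : ℝ, 0 < x → ContinuousOn (fun s => 1 / (s * x + (1 - s))) (Icc (0 : ℝ) 1) :=
    fun x hx => ContinuousOn.div (by fun_prop) (by fun_prop) fun s hs => (hpos x hx s hs).ne'
  refine (isOperatorAntitone_integral (μ := volume.restrict (Ioc (0 : ℝ) 1))
    (G := fun s x => 1 / (s * x + (1 - s))) ?_ fun x hx =>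
      ((hcont x hx).integrableOn_Icc.mono_set Ioc_subset_Icc_self)).congr fun x hx => ?_
  · filter_upwards [ae_restrict_mem measurableSet_Ioc] with s hs
    exact isOperatorAntitone_one_div_affine hs.1.le (sub_nonneg.2 hs.2) (by linarith)
  · rw [← intervalIntegral.integral_of_le zero_le_one]
    have hid : dslope (fun x : ℝ => x) 1 x = 1 := by
      rcases eq_or_ne x 1 with rfl | hx1
      · simp [dslope_same]
      · rw [dslope_of_ne _ hx1, slope_def_field, div_self (sub_ne_zero.2 hx1)]
    rw [hid, one_mul]
    rcases eq_or_ne x 1 with rfl | hx1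
    · simp [dslope_same]
    · have h0 := sub_ne_zero.2 hx1
      have hu : uIcc (0 : ℝ) 1 = Icc 0 1 := uIcc_of_le zero_le_one
      rw [intervalIntegral.integral_eq_sub_of_hasDerivAt
        (f := fun s => Real.log (s * x + (1 - s)) / (x - 1)) (fun s hs => ?_)
        ((hcont x hx).mono hu.subset).intervalIntegrable, dslope_of_ne _ hx1, slope_def_field]
      · simp
      · rw [hu] at hs
        have h1 : HasDerivAt (fun s => s * x + (1 - s)) (x - 1) s := by
          refine (((hasDerivAt_id s).mul_const x).add
            ((hasDerivAt_id s).const_sub 1)).congr_deriv ?_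
          ring
        refine ((h1.log (hpos x hx s hs).ne').div_const (x - 1)).congr_deriv ?_
        have := (hpos x hx s hs).ne'
        field_simp

theorem isOperatorAntitone_dslope_rpow {p : ℝ} (hp : p ∈ Icc (-1 : ℝ) 2 \ {0, 1}) :
    IsOperatorAntitone fun x => dslope (fun x => x ^ p / p) 1 x *
      dslope (fun x => x ^ (1 - p) / (1 - p)) 1 x := by
  -- exchanging the two functions replaces `p` by `1 - p`
  wlog h : 1 / 2 ≤ p generalizing p
  · have hp' : 1 - p ∈ Icc (-1 : ℝ) 2 \ {0, 1} := by
      refine ⟨⟨by linarith [hp.1.2], by linarith [hp.1.1]⟩, ?_⟩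
      rintro (h0 | h0)
      · exact hp.2 (Or.inr (by rw [mem_singleton_iff]; linarith))
      · rw [mem_singleton_iff] at h0
        exact hp.2 (Or.inl (by linarith))
    have := this hp' (by linarith)
    simp only [sub_sub_cancel] at this
    exact this.congr fun x _ => mul_comm _ _
  have h1 : p ≠ 1 := fun h => hp.2 (Or.inr h)
  rcases lt_or_gt_of_ne h1 with h1 | h1
  · exact isOperatorAntitone_dslope_rpow_of_mem_Ioo_zero_one ⟨by linarith, h1⟩
  · rcases hp.1.2.eq_or_lt with rfl | h2
    · exact isOperatorAntitone_dslope_rpow_two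
    · exact isOperatorAntitone_dslope_rpow_of_mem_Ioo_one_two ⟨h1, h2⟩

/-- Unique differentiability lets the derivative at a point of `s` be read off within `s`, also at
the endpoint `1` of `(0, 1]`. -/
theorem dslope_mul_dslope_eq_of_affineEquivalentOn {s : Set ℝ} (hs : UniqueDiffOn ℝ s)
    {φ₀ χ₀ φ χ : ℝ → ℝ} (h : AffineEquivalentOn s φ₀ χ₀ φ χ)
    (hφ₀ : ∀ x ∈ s, DifferentiableAt ℝ φ₀ x) (hχ₀ : ∀ x ∈ s, DifferentiableAt ℝ χ₀ x)
    (hφ : ∀ x ∈ s, DifferentiableAt ℝ φ x) (hχ : ∀ x ∈ s, DifferentiableAt ℝ χ x)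
    {x y : ℝ} (hx : x ∈ s) (hy : y ∈ s) :
    dslope φ x y * dslope χ x y = dslope φ₀ x y * dslope χ₀ x y := by
  obtain ⟨A₁, A₂, B₁, B₂, hA, h⟩ := h
  have key : ∀ {ψ₀ ψ : ℝ → ℝ} {A B : ℝ}, (∀ x ∈ s, DifferentiableAt ℝ ψ₀ x) →
      (∀ x ∈ s, DifferentiableAt ℝ ψ x) → (∀ x ∈ s, ψ x = A * ψ₀ x + B) →
      dslope ψ x y = A * dslope ψ₀ x y := by
    intro ψ₀ ψ A B hψ₀ hψ hψψ
    rcases eq_or_ne y x with rfl | hxy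
    · have h1 : HasDerivWithinAt ψ (A * deriv ψ₀ y) s y :=
        (((hψ₀ y hx).hasDerivAt.const_mul A).add_const B).hasDerivWithinAt.congr hψψ (hψψ y hx)
      rw [dslope_same, dslope_same]
      exact (hs y hx).eq_deriv s (hψ y hx).hasDerivAt.hasDerivWithinAt h1
    · rw [dslope_of_ne _ hxy, dslope_of_ne _ hxy, slope_def_field, slope_def_field, hψψ x hx,
        hψψ y hy]
      ring
  rw [key hφ₀ hφ fun x hx => (h x hx).1, key hχ₀ hχ fun x hx => (h x hx).2, mul_mul_mul_comm, hA,
    one_mul]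

theorem IsWYDPairOn.exists_isNormalisedSymmetricOperatorMonotone {s : Set ℝ}
    (hs : UniqueDiffOn ℝ s) (hpos : s ⊆ Ioi 0) {φ χ : ℝ → ℝ} (hφ : DifferentiableOn ℝ φ (Ioi 0))
    (hχ : DifferentiableOn ℝ χ (Ioi 0)) (h : IsWYDPairOn s φ χ) :
    ∃ f, IsNormalisedSymmetricOperatorMonotone f ∧ ∀ x ∈ s, ∀ y ∈ s,
      dslope φ x y * dslope χ x y = cmFunction f x y := by
  obtain ⟨p, φ₀, χ₀, hP, ha, he⟩ : ∃ (p : ℝ) (φ₀ χ₀ : ℝ → ℝ), IsPowerPair p φ₀ χ₀ ∧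
      (IsOperatorAntitone fun x => dslope φ₀ 1 x * dslope χ₀ 1 x) ∧
      AffineEquivalentOn s φ₀ χ₀ φ χ := by
    rcases h with ⟨p, hp, h⟩ | h | h
    · exact ⟨p, _, _, isPowerPair_rpow (fun h => hp.2 (Or.inl h)) (fun h => hp.2 (Or.inr h)),
        isOperatorAntitone_dslope_rpow hp, h⟩
    · exact ⟨1, _, _, isPowerPair_id_log, isOperatorAntitone_dslope_id_log, h⟩
    · exact ⟨1 - 1, _, _, isPowerPair_id_log.swap,
        isOperatorAntitone_dslope_id_log.congr fun x _ => mul_comm _ _, h⟩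
  obtain ⟨f, hf, hfc⟩ := hP.exists_isNormalisedSymmetricOperatorMonotone ha
  refine ⟨f, hf, fun x hx y hy => ?_⟩
  rw [← hfc x y (hpos hx) (hpos hy)]
  exact dslope_mul_dslope_eq_of_affineEquivalentOn hs he
    (fun z hz => (hP.hasDerivAt_fst z (hpos hz)).differentiableAt)
    (fun z hz => (hP.hasDerivAt_snd z (hpos hz)).differentiableAt)
    (fun z hz => hφ.differentiableAt (Ioi_mem_nhds (mem_Ioi.1 (hpos hz))))
    (fun z hz => hχ.differentiableAt (Ioi_mem_nhds (mem_Ioi.1 (hpos hz)))) hx hy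

/-! ### The characterisation -/

theorem le_one_of_mem_spectrum_of_trace_eq_one {n : ℕ} {ρ : Matrix (Fin n) (Fin n) ℂ}
    (hρ : ρ.PosDef) (h : ρ.trace = 1) {x : ℝ} (hx : x ∈ spectrum ℝ ρ) : x ≤ 1 := by
  rw [hρ.isHermitian.spectrum_real_eq_range_eigenvalues] at hx
  obtain ⟨i, rfl⟩ := hx
  rw [hρ.isHermitian.trace_eq_sum_eigenvalues] at h
  have h' : ∑ i, hρ.isHermitian.eigenvalues i = 1 :=
    Complex.ofReal_injective (by push_cast; exact h)
  rw [← h']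
  exact Finset.single_le_sum (f := hρ.isHermitian.eigenvalues)
    (fun j _ => (hρ.eigenvalues_pos j).le) (Finset.mem_univ i)

theorem theorem5p2 (φ χ : ℝ → ℝ)
    (hφ : ContDiffOn ℝ 1 φ (Set.Ioi 0)) (hχ : ContDiffOn ℝ 1 χ (Set.Ioi 0)) :
    (InducesPairedMonotoneMetric φ χ ↔ IsWYDPairOn (Set.Ioi 0) φ χ) ∧
    (InducesPairedMonotoneMetricOnDensities φ χ ↔ IsWYDPairOn (Set.Ioc 0 1) φ χ) := by
  have hdφ := hφ.differentiableOn one_ne_zero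
  have hdχ := hχ.differentiableOn one_ne_zero
  refine ⟨⟨isWYDPairOn_Ioi_of_inducesPairedMonotoneMetric hφ hχ, fun h => ?_⟩,
    ⟨isWYDPairOn_Ioc_of_inducesPairedMonotoneMetricOnDensities hφ hχ, fun h => ?_⟩⟩
  · obtain ⟨f, hf, hfc⟩ := h.exists_isNormalisedSymmetricOperatorMonotone
      isOpen_Ioi.uniqueDiffOn subset_rfl hdφ hdχ
    exact ⟨f, hf, fun n ρ hρ A B hA hB => pairedForm_eq_monotoneMetric hρ hA hB hdφ hdχ
      fun x hx y hy => hfc x (pos_of_mem_spectrum_of_posDef hρ hx) y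
        (pos_of_mem_spectrum_of_posDef hρ hy)⟩
  · obtain ⟨f, hf, hfc⟩ := h.exists_isNormalisedSymmetricOperatorMonotone
      (uniqueDiffOn_Ioc 0 1) (fun x hx => hx.1) hdφ hdχ
    have hmem : ∀ {n : ℕ} {ρ : Matrix (Fin n) (Fin n) ℂ}, ρ.PosDef → ρ.trace = 1 →
        spectrum ℝ ρ ⊆ Ioc 0 1 := fun hρ htr x hx =>
      ⟨pos_of_mem_spectrum_of_posDef hρ hx, le_one_of_mem_spectrum_of_trace_eq_one hρ htr hx⟩
    exact ⟨f, hf, fun n ρ hρ htr A B hA _ hB _ => pairedForm_eq_monotoneMetric hρ hA hB hdφ hdχ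
      fun x hx y hy => hfc x (hmem hρ htr hx) y (hmem hρ htr hy)⟩
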